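/- Let $X=(X_1,\dots,X_d)$ be a random vector in $\mathbb R^d$ and $R\in\{0,1\}^d$ its response pattern ($R_j=1$ iff $X_j$ is observed). For $r\in\{0,1\}^d$ write $x_r$ and $x_{\bar r}$ for the subvectors of $x$ with $r_j=1$ and $r_j=0$, respectively. Let $G$ be an undirected graph on $\{1,\dots,d\}$; for a vertex set $s$ let $N_G(s)$ be the set of vertices outside $s$ adjacent to a vertex of $s$, and $\bar N_G(s)=s\cup N_G(s)$; write $R_A=1$ if $R_j=1$ for all $j\in A$. Assume that the data are missing completely at random (MCAR: $R$ is independent of $X$) and that the distribution of $X$ is faithful to $G$: for all pairwise disjoint $A,B,C\subseteq\{1,\dots,d\}$, $X_A\perp X_B\mid X_C$ if and only if $C$ separates $A$ from $B$ in $G$. (1) Let $r$ be a pattern with $P(R=r)>0$ and let $s_1,\dots,s_K$ be the connected components of the subgraph of $G$ induced on the missing variables $\{j:r_j=0\}$; assume $P(R_{\bar N_G(s_k)}=1)>0$ for every $k$, so that the model below is defined. Then the nonparametric Markov missing graph (NP-MMG) imputation model recovers the true imputation model: for almost every $x$, $$\prod_{k=1}^K p\bigl(x_{s_k}\mid x_{N_G(s_k)},\,R_{\bar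 N_G(s_k)}=1\bigr)=p(x_{\bar r}\mid x_r,\,R=r)=p(x_{\bar r}\mid x_r),$$ where $p(\cdot\mid\cdot)$ denotes (regular) conditional distributions and the product is the product distribution. (2) Suppose moreover that $X$ is multivariate normal with nonsingular covariance matrix and that $P(R=(1,\dots,1))>0$. Fix $j$ and let $(\mathbf X_i,\mathbf R_i)$, $i\ge 1$, be i.i.d. copies of $(X,R)$. The complete-case estimator of $\mathbb E X_j$ is $\hat\mu_{\rm CC}=\sum_{i\le n} I(\mathbf R_i=(1,\dots,1))\mathbf X_{i,j}\big/\sum_{i\le n} I(\mathbf R_i=(1,\dots,1))$. The Gaussian Markov missing graph (G-MMG) estimator is $$\hat\mu_{\rm GMMG}=\frac1n\sum_{i=1}^n\Bigl(\mathbf R_{i,j}\mathbf X_{i,j}+(1-\mathbf R_{i,j})\,\hat m_{s^{(i)}}(\mathbf X_{i,N_G(s^{(i)})})\Bigr),$$ where $s^{(i)}$ is the connected component containing $j$ of the variables missing for case $i$, and $\hat m_s(x_{N_G(s)})$ is the conditional mean of $X_j$ given $X_{N_G(s)}=x_{N_G(s)}$ under the normal distribution for $X_{\bar N_G(s)}$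 fitted by maximum likelihood to all cases $i\le n$ with $\mathbf R_{i,\bar N_G(s)}=1$ (any measurable choice when no maximizer exists). Then $\sqrt n(\hat\mu_{\rm GMMG}-\mathbb E X_j)$ and $\sqrt n(\hat\mu_{\rm CC}-\mathbb E X_j)$ converge in distribution to centered normal laws whose variances $V_{\rm GMMG}$, $V_{\rm CC}$ satisfy $V_{\rm GMMG}\le V_{\rm CC}$. The inequality is strict whenever, with positive probability, an incomplete case has an observed variable in the connected component of $j$ in $G$. -/

import Mathlib

open MeasureTheory ProbabilityTheory Filter Topology
open scoped Matrix

noncomputable section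

namespace MMG

/-! ### Response patterns and graph notions -/

/-- Response patterns: `r v = true` when the variable `v` is observed, `false` when missing. -/
abbrev Pattern (d : ℕ) : Type := Fin d → Bool

/-- The observed variables of a pattern. -/
def observed {d : ℕ} (r : Pattern d) : Finset (Fin d) :=
  Finset.univ.filter fun v => r v = true

/-- The missing variables of a pattern. -/
def missing {d : ℕ} (r : Pattern d) : Finset (Fin d) :=
  Finset.univ.filter fun v => r v = false

open Classical in
/-- The neighbours of a set `s` of vertices that do not lie in `s`. -/
def nbhd {d : ℕ} (G : SimpleGraph (Fin d)) (s : Finset (Fin d)) : Finset (Fin d) :=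
  Finset.univ.filter fun v => v ∉ s ∧ ∃ u ∈ s, G.Adj u v

/-- A set of vertices together with its neighbours. -/
def closedNbhd {d : ℕ} (G : SimpleGraph (Fin d)) (s : Finset (Fin d)) : Finset (Fin d) :=
  s ∪ nbhd G s

open Classical in
/-- The connected component of `v` in the subgraph of `G` on the variables missing under `r`
(empty when `v` is observed under `r`). -/
def missComp {d : ℕ} (G : SimpleGraph (Fin d)) (r : Pattern d) (v : Fin d) : Finset (Fin d) :=
  Finset.univ.filter fun w => ∃ (hv : r v = false) (hw : r w = false),
    (G.induce {u | r u = false}).Reachable ⟨v, hv⟩ ⟨w, hw⟩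

/-- All connected components of the subgraph of `G` on the variables missing under `r`. -/
def missComps {d : ℕ} (G : SimpleGraph (Fin d)) (r : Pattern d) : Finset (Finset (Fin d)) :=
  (missing r).image (missComp G r)

/-- Connected patterns: nonempty vertex sets that induce a connected subgraph. -/
def IsConnectedPattern {d : ℕ} (G : SimpleGraph (Fin d)) (s : Finset (Fin d)) : Prop :=
  (G.induce (s : Set (Fin d))).Connected

theorem mem_missComp_self {d : ℕ} (G : SimpleGraph (Fin d)) {r : Pattern d} {v : Fin d}
    (hv : r v = false) : v ∈ missComp G r v := by
  simp [missComp, hv]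

theorem mem_closedNbhd_missComp {d : ℕ} (G : SimpleGraph (Fin d)) {r : Pattern d} {v : Fin d}
    (hv : r v = false) : v ∈ closedNbhd G (missComp G r v) :=
  Finset.mem_union_left _ (mem_missComp_self G hv)

theorem eq_false_of_mem_missing {d : ℕ} {r : Pattern d} {v : Fin d} (hv : v ∈ missing r) :
    r v = false := by
  simpa [missing] using hv

theorem missComp_mem_missComps {d : ℕ} (G : SimpleGraph (Fin d)) {r : Pattern d} {v : Fin d}
    (hv : v ∈ missing r) : missComp G r v ∈ missComps G r :=
  Finset.mem_image_of_mem _ hv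

/-! ### Faithfulness -/

/-- `C` separates `A` from `B` in `G`: every path from `A` to `B` meets `C`. -/
def Separates {d : ℕ} (G : SimpleGraph (Fin d)) (A B C : Finset (Fin d)) : Prop :=
  ∀ a ∈ A, ∀ b ∈ B, ∀ w : G.Walk a b, ∃ c ∈ C, c ∈ w.support

/-- Under the distribution `μ` of a random vector `x`, the subvectors `x_A` and `x_B` are
conditionally independent given `x_C`. -/
def CondIndepOn {d : ℕ} (μ : Measure (Fin d → ℝ)) [IsFiniteMeasure μ]
    (A B C : Finset (Fin d)) : Prop :=
  CondIndepFun (MeasurableSpace.comap (fun x : Fin d → ℝ => C.restrict x) inferInstance)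
    (Measurable.comap_le (Finset.measurable_restrict C))
    (fun x : Fin d → ℝ => A.restrict x) (fun x : Fin d → ℝ => B.restrict x) μ

/-- `μ` is faithful to `G`: the conditional independences among disjoint subvectors are exactly
the ones given by separation in `G` (this includes the global Markov property). -/
def Faithful {d : ℕ} (G : SimpleGraph (Fin d)) (μ : Measure (Fin d → ℝ))
    [IsFiniteMeasure μ] : Prop :=
  ∀ A B C : Finset (Fin d), Disjoint A B → Disjoint A C → Disjoint B C →
    (CondIndepOn μ A B C ↔ Separates G A B C)

/-! ### The nonparametric imputation model -/

/-- The event that all variables in `T` are observed. -/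
def obsEvent {Ω : Type*} {d : ℕ} (R : Ω → Pattern d) (T : Finset (Fin d)) : Set Ω :=
  {ω | ∀ v ∈ T, R ω v = true}

/-- Assembles subvectors indexed by the connected components of the missing variables into one
vector indexed by the missing variables. -/
def glue {d : ℕ} (G : SimpleGraph (Fin d)) (r : Pattern d)
    (y : ∀ s : missComps G r, s.1 → ℝ) : missing r → ℝ :=
  fun v => y ⟨missComp G r v.1, missComp_mem_missComps G v.2⟩
    ⟨v.1, mem_missComp_self G (eq_false_of_mem_missing v.2)⟩

/-- The nonparametric Markov missing graph model for the missing variables under the pattern `r`: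
the product, over the connected components `s` of the missing variables, of the conditional
distributions of `X_s` given `X_{N(s)} = x_{N(s)}` among the cases in which all variables of
`s` and `N(s)` are observed. It uses only the coordinates of `x` in the sets `N(s)`, all of which
are observed under `r`. -/
def npMMG {Ω : Type*} [MeasurableSpace Ω] {d : ℕ} (P : Measure Ω) [IsProbabilityMeasure P]
    (X : Ω → Fin d → ℝ) (R : Ω → Pattern d) (G : SimpleGraph (Fin d)) (r : Pattern d)
    (x : Fin d → ℝ) : Measure (missing r → ℝ) :=
  (Measure.pi fun s : missComps G r =>
    condDistrib (fun ω => s.1.restrict (X ω)) (fun ω => (nbhd G s.1).restrict (X ω))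
      (P[|obsEvent R (closedNbhd G s.1)]) ((nbhd G s.1).restrict x)).map (glue G r)

/-- The true imputation model among the cases with pattern `r`:
the conditional distribution of the missing variables given the observed ones and `R = r`. -/
def extrapolation {Ω : Type*} [MeasurableSpace Ω] {d : ℕ} (P : Measure Ω) [IsProbabilityMeasure P]
    (X : Ω → Fin d → ℝ) (R : Ω → Pattern d) (r : Pattern d) (x : Fin d → ℝ) :
    Measure (missing r → ℝ) :=
  condDistrib (fun ω => (missing r).restrict (X ω)) (fun ω => (observed r).restrict (X ω))
    (P[|R ⁻¹' {r}]) ((observed r).restrict x)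

/-- The conditional distribution `p(x_{r̄} | x_r)` in the whole population. -/
def trueConditional {Ω : Type*} [MeasurableSpace Ω] {d : ℕ} (P : Measure Ω)
    [IsProbabilityMeasure P] (X : Ω → Fin d → ℝ) (r : Pattern d) (x : Fin d → ℝ) :
    Measure (missing r → ℝ) :=
  condDistrib (fun ω => (missing r).restrict (X ω)) (fun ω => (observed r).restrict (X ω))
    P ((observed r).restrict x)

/-! ### The Gaussian imputation model -/

/-- Mean and covariance parameters of a Gaussian model for variables indexed by `ι`. -/
structure GaussParam (ι : Type*) where
  /-- the mean vector -/
  mean : ι → ℝ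
  /-- the covariance matrix -/
  cov : Matrix ι ι ℝ

/-- Gaussian negative log-likelihood, up to an additive constant. -/
def gaussLoss {ι : Type*} [Fintype ι] [DecidableEq ι] (θ : GaussParam ι) (x : ι → ℝ) : ℝ :=
  1 / 2 * Real.log θ.cov.det + 1 / 2 * ((x - θ.mean) ⬝ᵥ (θ.cov⁻¹ *ᵥ (x - θ.mean)))

/-- The conditional mean of coordinate `a` given the coordinates in `N` being those of `x`, under
the normal distribution with parameter `θ`. -/
def gaussCondMean {ι : Type*} [DecidableEq ι] (θ : GaussParam ι) (a : ι)
    (N : Finset ι) (x : ι → ℝ) : ℝ :=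
  θ.mean a + (fun u : N => θ.cov a u) ⬝ᵥ
    ((θ.cov.submatrix (fun u : N => (u : ι)) (fun u : N => (u : ι)))⁻¹ *ᵥ
      fun u : N => x u - θ.mean u)

open Classical in
/-- The empirical imputation risk of the Gaussian submodel for the connected pattern `s`, from the
first `n` cases: only those with all variables in `s` and its neighbourhood observed enter. -/
def empRisk {d : ℕ} (G : SimpleGraph (Fin d)) (s : Finset (Fin d)) (n : ℕ)
    (xs : ℕ → Fin d → ℝ) (rs : ℕ → Pattern d) (θ : GaussParam (closedNbhd G s)) : ℝ :=
  (n : ℝ)⁻¹ * ∑ i ∈ Finset.range n,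
    if ∀ v ∈ closedNbhd G s, rs i v = true then
      gaussLoss θ ((closedNbhd G s).restrict (xs i)) else 0

/-- `θ` minimizes the empirical imputation risk over all means and all positive definite
covariance matrices. -/
def IsRiskMin {d : ℕ} (G : SimpleGraph (Fin d)) (s : Finset (Fin d)) (n : ℕ)
    (xs : ℕ → Fin d → ℝ) (rs : ℕ → Pattern d) (θ : GaussParam (closedNbhd G s)) : Prop :=
  θ.cov.PosDef ∧ ∀ θ' : GaussParam (closedNbhd G s), θ'.cov.PosDef →
    empRisk G s n xs rs θ ≤ empRisk G s n xs rs θ'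

/-- `θ n s` is, for every sample size `n` and connected pattern `s`, a (measurable) maximum
likelihood fit of the Gaussian submodel for `s` from the first `n` cases. When the likelihood has
no maximizer (too few cases), the value is left unrestricted. -/
structure IsGaussianFit {Ω : Type*} [MeasurableSpace Ω] {d : ℕ} (G : SimpleGraph (Fin d))
    (X : ℕ → Ω → Fin d → ℝ) (R : ℕ → Ω → Pattern d)
    (θ : ℕ → (s : Finset (Fin d)) → Ω → GaussParam (closedNbhd G s)) : Prop where
  measurable_mean : ∀ n s u, Measurable fun ω => (θ n s ω).mean u
  measurable_cov : ∀ n s u v, Measurable fun ω => (θ n s ω).cov u v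
  minimizes : ∀ n s ω, IsConnectedPattern G s →
    (∃ ϑ, IsRiskMin G s n (fun i => X i ω) (fun i => R i ω) ϑ) →
      IsRiskMin G s n (fun i => X i ω) (fun i => R i ω) (θ n s ω)

/-- The value used for variable `j` of a case with data `x` and pattern `r`: the observed value, or,
if it is missing, its fitted conditional mean given the neighbours of the connected component
of missing variables that contains `j`. -/
def imputed {d : ℕ} (G : SimpleGraph (Fin d)) (θ : (s : Finset (Fin d)) → GaussParam (closedNbhd G s))
    (j : Fin d) (x : Fin d → ℝ) (r : Pattern d) : ℝ :=
  if hj : r j = false then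
    gaussCondMean (θ (missComp G r j)) ⟨j, mem_closedNbhd_missComp G hj⟩
      (Finset.univ.filter fun u => u.1 ∈ nbhd G (missComp G r j))
      ((closedNbhd G (missComp G r j)).restrict x)
  else x j

/-- The Gaussian Markov missing graph estimator of the mean of variable `j`. -/
def gmmgEstimator {d : ℕ} (G : SimpleGraph (Fin d))
    (θ : (s : Finset (Fin d)) → GaussParam (closedNbhd G s)) (j : Fin d) (n : ℕ)
    (xs : ℕ → Fin d → ℝ) (rs : ℕ → Pattern d) : ℝ :=
  (n : ℝ)⁻¹ * ∑ i ∈ Finset.range n, imputed G θ j (xs i) (rs i)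

open Classical in
/-- The complete-case estimator of the mean of variable `j`. -/
def ccEstimator {d : ℕ} (j : Fin d) (n : ℕ) (xs : ℕ → Fin d → ℝ) (rs : ℕ → Pattern d) : ℝ :=
  (∑ i ∈ Finset.range n, if ∀ v, rs i v = true then xs i j else 0) /
    ∑ i ∈ Finset.range n, if ∀ v, rs i v = true then (1 : ℝ) else 0

/-- The estimators `T n` of `m` are asymptotically normal at rate `√n` with asymptotic
variance `V`. -/
def HasAsympVar {Ω : Type*} [MeasurableSpace Ω] (P : Measure Ω) [IsProbabilityMeasure P]
    (T : ℕ → Ω → ℝ) (m : ℝ) (V : NNReal) : Prop :=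
  TendstoInDistribution (fun (n : ℕ) ω => √(n : ℝ) * (T n ω - m)) atTop
    (id : ℝ → ℝ) (fun _ => P) (gaussianReal 0 V)

end MMG

end

/-!
**Recovery.** By faithfulness, `X_s` is independent of the remaining variables given `X_{N(s)}`, for
every component `s` of the missing variables, and `N(s)` consists of observed variables. Hence, in
an integral against a function of the observed variables, the events about the components can be
replaced one after the other by their conditional probabilities given the neighbours
(`MMG.lintegral_prod_indicator_mul`). This factorizes the joint law of the observed and the missing
variables (`MMG.map_eq_compProd_piKernel`) and identifies the conditional law of the missing
variables as a product. Since the data are missing completely at random, conditioning on an event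
about the response pattern does not change the law of `X`, so that the three kernels may be compared
under the law of `X` alone (`MMG.npMMG_ae_eq`).

**Asymptotic normality.** Almost surely, for large samples, the maximum likelihood fit for each
component is the sample mean and the sample covariance matrix of the cases that enter it
(`MMG.IsGaussianFit.eq_sample`). Write `z = X_j - E X_j`, let `e_s` be the residual of the
population regression of `X_j` on `X_{N(s)}`, `κ_s` the indicator that `s` is the component of
missing variables that contains `j`, `w_s` the indicator that `s` and `N(s)` are observed, and
`π_s`, `q_s` the probabilities of these two events. The error of the estimator is exactly a
combination of averages of centered functions of the cases, with random coefficients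
(`MMG.gmmgEstimator_sub_eq`). By the law of large numbers the coefficients converge, so that they
may be replaced by their limits (`MMG.hasAsympVar_of_expansion`), and the central limit theorem
applies to the influence function `φ = w z + ∑ s, (κ_s (z - e_s) + (π_s / q_s) w_s e_s)`, where `w`
indicates that `j` is observed. In the same way, the complete-case estimator has the asymptotic
variance `c / p`, where `c` is the variance of `X_j` and `p` the probability of a complete case.

**Comparison.** Let `σ_s` be the variance of `e_s`, which is also its covariance with `z`, and put
`π = ∑ π_s` and `a = ∑ π_s σ_s`. On the cases with `j` observed, the Cauchy–Schwarz inequality gives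
`(∑ (π_s / q_s) w_s e_s)² ≤ π ∑ (π_s / q_s²) w_s e_s²`. This avoids any computation of the joint law
of the residuals, and integrating it yields `E φ² ≤ c + a + π ∑ π_s σ_s / q_s ≤ c + a (1 + π / p)`.
Because `a ≤ π c` and `π + p ≤ 1`, the bound is at most `c + π c (1 + π / p) ≤ c / p`
(`MMG.RegularMCAR.add_mul_le_div`). It is strict when `π + p < 1`, that is, when an incomplete case
may have `j` observed, and when `a < π c`, that is, when some `σ_s < c`. The latter holds if `X_j`
is correlated with a neighbour of the component, which faithfulness guarantees as soon as the
neighbour is joined to `j` by a path: otherwise the two Gaussian variables would be independent,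
although the empty set does not separate them (`MMG.covMat_ne_zero_of_reachable`).
-/

namespace MMG

/-! ### Components of the missing variables -/

section Graph

variable {d : ℕ} {G : SimpleGraph (Fin d)} {r : Pattern d}

@[simp] lemma mem_observed {v : Fin d} : v ∈ observed r ↔ r v = true := by simp [observed]

@[simp] lemma mem_missing {v : Fin d} : v ∈ missing r ↔ r v = false := by simp [missing]

lemma mem_missComp {v w : Fin d} : w ∈ missComp G r v ↔ ∃ (hv : r v = false) (hw : r w = false),
    (G.induce {u | r u = false}).Reachable ⟨v, hv⟩ ⟨w, hw⟩ := by
  simp [missComp]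

lemma mem_nbhd {s : Finset (Fin d)} {v : Fin d} :
    v ∈ nbhd G s ↔ v ∉ s ∧ ∃ u ∈ s, G.Adj u v := by
  simp [nbhd]

lemma disjoint_nbhd (s : Finset (Fin d)) : Disjoint s (nbhd G s) :=
  Finset.disjoint_left.2 fun _ hv hn => (mem_nbhd.1 hn).1 hv

lemma eq_false_of_mem_missComp {v w : Fin d} (hw : w ∈ missComp G r v) : r w = false := by
  obtain ⟨_, h, _⟩ := mem_missComp.1 hw
  exact h

lemma missComp_eq_of_mem {v w : Fin d} (hw : w ∈ missComp G r v) :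
    missComp G r w = missComp G r v := by
  obtain ⟨hv, hw', h⟩ := mem_missComp.1 hw
  ext u
  simp only [mem_missComp]
  exact ⟨fun ⟨_, hu, h'⟩ => ⟨hv, hu, h.trans h'⟩, fun ⟨_, hu, h'⟩ => ⟨hw', hu, h.symm.trans h'⟩⟩

lemma mem_missComps {s : Finset (Fin d)} :
    s ∈ missComps G r ↔ ∃ v, r v = false ∧ missComp G r v = s := by
  simp [missComps]

/-- A missing neighbour of a component would belong to the component. -/
lemma eq_true_of_mem_nbhd_missComp {v u : Fin d} (hu : u ∈ nbhd G (missComp G r v)) :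
    r u = true := by
  obtain ⟨hu', w, hw, hadj⟩ := mem_nbhd.1 hu
  by_contra hr
  obtain ⟨hv, hw', h⟩ := mem_missComp.1 hw
  have hr' : r u = false := by simpa using hr
  refine hu' (mem_missComp.2 ⟨hv, hr', h.trans (SimpleGraph.Adj.reachable ?_)⟩)
  simpa using hadj

lemma nbhd_subset_observed {s : Finset (Fin d)} (hs : s ∈ missComps G r) :
    nbhd G s ⊆ observed r := by
  obtain ⟨v, -, rfl⟩ := mem_missComps.1 hs
  exact fun u hu => mem_observed.2 (eq_true_of_mem_nbhd_missComp hu)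

lemma subset_missing {s : Finset (Fin d)} (hs : s ∈ missComps G r) : s ⊆ missing r := by
  obtain ⟨v, -, rfl⟩ := mem_missComps.1 hs
  exact fun u hu => mem_missing.2 (eq_false_of_mem_missComp hu)

lemma disjoint_of_mem_missComps {s t : Finset (Fin d)} (hs : s ∈ missComps G r)
    (ht : t ∈ missComps G r) (hst : s ≠ t) : Disjoint s t := by
  obtain ⟨v, -, rfl⟩ := mem_missComps.1 hs
  obtain ⟨w, -, rfl⟩ := mem_missComps.1 ht
  refine Finset.disjoint_left.2 fun u hu hu' => hst ?_
  rw [← missComp_eq_of_mem hu, ← missComp_eq_of_mem hu']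

/-- The neighbours of a set separate it from the rest of the graph. -/
lemma separates_nbhd (s : Finset (Fin d)) :
    Separates G s (closedNbhd G s)ᶜ (nbhd G s) := by
  intro a ha b hb w
  have hb' : b ∉ closedNbhd G s := by simpa using hb
  induction w with
  | nil => exact absurd (Finset.mem_union_left _ ha) hb'
  | @cons u v c hadj p ih =>
    by_cases hv : v ∈ s
    · obtain ⟨x, hx, hx'⟩ := ih hv hb hb'
      exact ⟨x, hx, by simp [hx']⟩
    · exact ⟨v, mem_nbhd.2 ⟨hv, u, ha, hadj⟩, by simp⟩

lemma isConnectedPattern_missComp {v : Fin d} (hv : r v = false) :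
    IsConnectedPattern G (missComp G r v) := by
  have hv0 := mem_missComp_self G hv
  have key : ∀ (a b : {u | r u = false}) (_ : (G.induce {u | r u = false}).Walk a b)
      (ha : a.1 ∈ missComp G r v), ∃ hb : b.1 ∈ missComp G r v,
      (G.induce (missComp G r v : Set (Fin d))).Reachable ⟨a.1, ha⟩ ⟨b.1, hb⟩ := by
    intro a b w
    induction w with
    | nil => exact fun ha => ⟨ha, SimpleGraph.Reachable.refl _⟩
    | @cons x y z hadj p ih =>
      intro ha
      have hy : y.1 ∈ missComp G r v := by
        obtain ⟨h1, h2, h3⟩ := mem_missComp.1 ha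
        exact mem_missComp.2 ⟨h1, y.2, h3.trans hadj.reachable⟩
      obtain ⟨hb, h⟩ := ih hy
      refine ⟨hb, SimpleGraph.Reachable.trans (SimpleGraph.Adj.reachable ?_) h⟩
      simpa using hadj
  have hreach : ∀ w : (missComp G r v : Set (Fin d)),
      (G.induce (missComp G r v : Set (Fin d))).Reachable ⟨v, hv0⟩ w := by
    rintro ⟨w, hw⟩
    obtain ⟨h1, h2, ⟨p⟩⟩ := mem_missComp.1 hw
    exact (key _ _ p hv0).2
  have : Nonempty (missComp G r v : Set (Fin d)) := ⟨⟨v, hv0⟩⟩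
  exact SimpleGraph.Connected.mk fun a b => (hreach a).symm.trans (hreach b)

/-- A component of the missing variables from which an observed variable can be reached has a
neighbour, and this neighbour can be reached as well. -/
lemma exists_mem_nbhd_of_reachable {j v : Fin d} (hj : r j = false) (hv : r v = true)
    (h : G.Reachable j v) : ∃ u ∈ nbhd G (missComp G r j), G.Reachable j u := by
  obtain ⟨w⟩ := h
  have key : ∀ (a b : Fin d) (_ : G.Walk a b), a ∈ missComp G r j → b ∉ missComp G r j →
      ∃ u ∈ nbhd G (missComp G r j), G.Reachable a u := by
    intro a b w
    induction w with
    | nil => exact fun h1 h2 => absurd h1 h2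
    | @cons x y z hadj p ih =>
      intro ha hb
      by_cases hy : y ∈ missComp G r j
      · obtain ⟨u, hu, hr⟩ := ih hy hb
        exact ⟨u, hu, hadj.reachable.trans hr⟩
      · exact ⟨y, mem_nbhd.2 ⟨hy, x, ha, hadj⟩, hadj.reachable⟩
  refine key j v w (mem_missComp_self G hj) fun hv' => ?_
  simpa [hv] using eq_false_of_mem_missComp hv'

end Graph

/-! ### Recovery of the imputation model -/

section Recovery

variable {d : ℕ} {G : SimpleGraph (Fin d)} {r : Pattern d}

open Classical in
/-- Extends a subvector indexed by `s` to a full vector, with zeros outside `s`. -/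
noncomputable def extendZero (s : Finset (Fin d)) (y : s → ℝ) : Fin d → ℝ :=
  fun v => if h : v ∈ s then y ⟨v, h⟩ else 0

lemma measurable_extendZero (s : Finset (Fin d)) : Measurable (extendZero s) := by
  refine measurable_pi_lambda _ fun v => ?_
  by_cases h : v ∈ s
  · simpa [extendZero, h] using measurable_pi_apply _
  · simp [extendZero, h]

lemma extendZero_apply {s : Finset (Fin d)} {x : Fin d → ℝ} {v : Fin d} (hv : v ∈ s) :
    extendZero s (s.restrict x) v = x v := by
  simp [extendZero, hv]

/-- The conditional distribution of `x_s` given `x_{N(s)}` under `μ`. -/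
noncomputable def compKernel (μ : Measure (Fin d → ℝ)) [IsFiniteMeasure μ]
    (G : SimpleGraph (Fin d)) (s : Finset (Fin d)) : Kernel (nbhd G s → ℝ) (s → ℝ) :=
  condDistrib (fun x : Fin d → ℝ => s.restrict x) (fun x : Fin d → ℝ => (nbhd G s).restrict x) μ

instance (μ : Measure (Fin d → ℝ)) [IsFiniteMeasure μ] (s : Finset (Fin d)) :
    IsMarkovKernel (compKernel μ G s) := by
  unfold compKernel; infer_instance

/-- By the Markov property, an event about `x_s` may be replaced by its conditional probability
given the neighbours of `s`, inside an integral against any function of the other variables. -/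
lemma lintegral_indicator_mul_of_condIndepOn {μ : Measure (Fin d → ℝ)} [IsFiniteMeasure μ]
    {s : Finset (Fin d)} (h : CondIndepOn μ s (closedNbhd G s)ᶜ (nbhd G s))
    {A : Set (s → ℝ)} (hA : MeasurableSet A) {H : (Fin d → ℝ) → ENNReal} (hH : Measurable H)
    (hdep : DependsOn H (s : Set (Fin d))ᶜ) :
    ∫⁻ x, A.indicator 1 (s.restrict x) * H x ∂μ =
      ∫⁻ x, compKernel μ G s ((nbhd G s).restrict x) A * H x ∂μ := by
  classical
  set N := nbhd G s
  set B := (closedNbhd G s)ᶜ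
  have hms := Finset.measurable_restrict (X := fun _ : Fin d => ℝ) s
  have hmN := Finset.measurable_restrict (X := fun _ : Fin d => ℝ) N
  have hmB := Finset.measurable_restrict (X := fun _ : Fin d => ℝ) B
  have h1 := (condIndepFun_iff_condDistrib_prod_ae_eq_prodMkRight hms hmB hmN).1
    (CondIndepFun.symm h)
  have h2 := (condDistrib_ae_eq_iff_measure_eq_compProd _ hms.aemeasurable _).1 h1
  -- `H` seen as a function of the coordinates in `N` and in `B`, which together exhaust `sᶜ`
  let H' : (N → ℝ) × (B → ℝ) → ENNReal := fun p => H (extendZero N p.1 + extendZero B p.2)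
  have hH' : Measurable H' := hH.comp
    (((measurable_extendZero N).comp measurable_fst).add
      ((measurable_extendZero B).comp measurable_snd))
  have hHH' : ∀ x, H x = H' (N.restrict x, B.restrict x) := by
    intro x
    refine hdep fun v hv => ?_
    have hv' : v ∉ s := by simpa using hv
    by_cases hvN : v ∈ N
    · have hvB : v ∉ B := by simp [B, closedNbhd, N] at hvN ⊢; simp [hvN]
      simp [extendZero, hvN, hvB]
    · have hvB : v ∈ B := by simp [B, closedNbhd, N] at hvN ⊢; simp [hvN, hv']
      simp [extendZero, hvN, hvB]
  have hm1 : Measurable fun q : ((N → ℝ) × (B → ℝ)) × (s → ℝ) => A.indicator 1 q.2 * H' q.1 :=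
    ((measurable_one.indicator hA).comp measurable_snd).mul (hH'.comp measurable_fst)
  calc ∫⁻ x, A.indicator 1 (s.restrict x) * H x ∂μ
      = ∫⁻ q, A.indicator 1 q.2 * H' q.1
          ∂(μ.map fun x => ((N.restrict x, B.restrict x), s.restrict x)) := by
        rw [lintegral_map hm1 (by fun_prop)]
        simp_rw [hHH']
    _ = ∫⁻ p, compKernel μ G s p.1 A * H' p ∂(μ.map fun x => (N.restrict x, B.restrict x)) := by
        rw [h2, Measure.lintegral_compProd hm1]
        refine lintegral_congr fun p => ?_
        change ∫⁻ b, A.indicator 1 b * H' p ∂(compKernel μ G s p.1) = _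
        rw [lintegral_mul_const _ (measurable_one.indicator hA), lintegral_indicator_one hA]
    _ = _ := by
        rw [lintegral_map _ (by fun_prop)]
        · simp_rw [hHH']
          rfl
        · exact ((Kernel.measurable_coe _ hA).comp measurable_fst).mul hH'

/-- Markov property for several components of the missing variables at once: events about `x_s` may
all be replaced by their conditional probabilities given the neighbours. One component is replaced
at a time, which is possible because the neighbours of every component are observed, so that the
factors of the other components do not depend on `x_s`. -/
lemma lintegral_prod_indicator_mul {μ : Measure (Fin d → ℝ)} [IsFiniteMeasure μ]
    (h : ∀ s ∈ missComps G r, CondIndepOn μ s (closedNbhd G s)ᶜ (nbhd G s))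
    {A : ∀ s : Finset (Fin d), Set (s → ℝ)} (hA : ∀ s, MeasurableSet (A s))
    (T : Finset (Finset (Fin d))) (hT : T ⊆ missComps G r)
    {H : (Fin d → ℝ) → ENNReal} (hH : Measurable H)
    (hdep : DependsOn H (observed r : Set (Fin d))) :
    ∫⁻ x, (∏ s ∈ T, (A s).indicator 1 (s.restrict x)) * H x ∂μ =
      ∫⁻ x, (∏ s ∈ T, compKernel μ G s ((nbhd G s).restrict x) (A s)) * H x ∂μ := by
  classical
  induction T using Finset.induction_on generalizing H with
  | empty => simp
  | insert s T hs ih =>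
    have hsm : s ∈ missComps G r := hT (Finset.mem_insert_self _ _)
    have hT' : T ⊆ missComps G r := fun t ht => hT (Finset.mem_insert_of_mem ht)
    have hmeas : Measurable fun x : Fin d → ℝ =>
        (∏ t ∈ T, (A t).indicator (1 : (t → ℝ) → ENNReal) (t.restrict x)) * H x :=
      (Finset.measurable_fun_prod _ fun t _ => (measurable_one.indicator (hA t)).comp
        (Finset.measurable_restrict t)).mul hH
    simp_rw [Finset.prod_insert hs, mul_assoc]
    rw [lintegral_indicator_mul_of_condIndepOn (h s hsm) (hA s) hmeas]
    · rw [lintegral_congr fun x => mul_left_comm _ _ _, ih hT',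
        lintegral_congr fun x => mul_left_comm _ _ _]
      · exact ((Kernel.measurable_coe _ (hA s)).comp (Finset.measurable_restrict _)).mul hH
      · intro x y hxy
        have h1 : (nbhd G s).restrict x = (nbhd G s).restrict y := by
          ext u
          exact hxy _ (nbhd_subset_observed hsm u.2)
        simp only [h1, hdep hxy]
    · intro x y hxy
      have h1 : H x = H y := hdep fun v hv => hxy v fun hv' => by
        have := mem_missing.1 (subset_missing hsm hv')
        simp [this] at hv
      have h2 : ∀ t ∈ T, t.restrict x = t.restrict y := by
        intro t ht
        ext u
        refine hxy _ fun hu => ?_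
        have hne : s ≠ t := fun e => hs (e ▸ ht)
        exact Finset.disjoint_left.1 (disjoint_of_mem_missComps hsm (hT' ht) hne) hu u.2
      simp only [h1]
      congr 1
      exact Finset.prod_congr rfl fun t ht => by rw [h2 t ht]

/-- The product over the components of the missing variables of their conditional distributions
given their neighbours, as a kernel on the observed variables. -/
noncomputable def piKernel (μ : Measure (Fin d → ℝ)) [IsFiniteMeasure μ]
    (G : SimpleGraph (Fin d)) (r : Pattern d) :
    Kernel (observed r → ℝ) (∀ s : missComps G r, s.1 → ℝ) where
  toFun y := Measure.pi fun s : missComps G r =>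
    compKernel μ G s.1 ((nbhd G s.1).restrict (extendZero (observed r) y))
  measurable' := by
    refine Measurable.measure_of_isPiSystem_of_isProbabilityMeasure generateFrom_pi.symm
      isPiSystem_pi ?_
    rintro _ ⟨A, hA, rfl⟩
    simp only [Measure.pi_pi]
    exact Finset.measurable_fun_prod _ fun s _ => (Kernel.measurable_coe _
      (show MeasurableSet (A s) from hA s trivial)).comp
      ((Finset.measurable_restrict _).comp (measurable_extendZero _))

instance (μ : Measure (Fin d → ℝ)) [IsFiniteMeasure μ] : IsMarkovKernel (piKernel μ G r) :=
  ⟨fun y => by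
    change IsProbabilityMeasure (Measure.pi _)
    infer_instance⟩

lemma measurable_glue : Measurable (glue G r) :=
  measurable_pi_lambda _ fun _ => (measurable_pi_apply _).comp (measurable_pi_apply _)

lemma nbhd_restrict_extendZero {s : Finset (Fin d)} (hs : s ∈ missComps G r) (x : Fin d → ℝ) :
    (nbhd G s).restrict (extendZero (observed r) ((observed r).restrict x)) =
      (nbhd G s).restrict x := by
  ext u
  exact extendZero_apply (nbhd_subset_observed hs u.2)

/-- Factorization of the law of the observed variables and the components of the missing ones. -/
lemma map_eq_compProd_piKernel {μ : Measure (Fin d → ℝ)} [IsFiniteMeasure μ]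
    (h : ∀ s ∈ missComps G r, CondIndepOn μ s (closedNbhd G s)ᶜ (nbhd G s)) :
    μ.map (fun x => ((observed r).restrict x, fun s : missComps G r => s.1.restrict x)) =
      μ.map (fun x => (observed r).restrict x) ⊗ₘ piKernel μ G r := by
  classical
  have hmo := Finset.measurable_restrict (X := fun _ : Fin d => ℝ) (observed r)
  have hmc : Measurable fun (x : Fin d → ℝ) (s : missComps G r) => s.1.restrict x :=
    measurable_pi_lambda _ fun s => Finset.measurable_restrict s.1
  have hm := hmo.prodMk hmc
  refine ext_of_generate_finite _ (generateFrom_eq_prod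
    MeasurableSpace.generateFrom_measurableSet generateFrom_pi
    isCountablySpanning_measurableSet
    (IsCountablySpanning.pi fun _ => isCountablySpanning_measurableSet)).symm
    (MeasurableSpace.isPiSystem_measurableSet.prod isPiSystem_pi) ?_ ?_
  · rintro _ ⟨B, hB, _, ⟨A, hA, rfl⟩, rfl⟩
    have hA' : ∀ s, MeasurableSet (A s) := fun s => hA s trivial
    have hB' : MeasurableSet B := hB
    let A' : ∀ s : Finset (Fin d), Set (s → ℝ) := fun s =>
      if hs : s ∈ missComps G r then A ⟨s, hs⟩ else Set.univ
    have hA'' : ∀ s, MeasurableSet (A' s) := by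
      intro s
      by_cases hs : s ∈ missComps G r
      · simpa [A', hs] using hA' _
      · simp [A', hs]
    have hAA' : ∀ s : missComps G r, A' s.1 = A s := fun s => by simp [A', s.2]
    have hHm : Measurable fun x : Fin d → ℝ =>
        B.indicator (1 : (observed r → ℝ) → ENNReal) ((observed r).restrict x) :=
      (measurable_one.indicator hB').comp hmo
    have key := lintegral_prod_indicator_mul h hA'' (missComps G r) subset_rfl hHm (by
      intro x y hxy
      have : (observed r).restrict x = (observed r).restrict y := by
        ext u; exact hxy _ u.2
      simp only [this])
    rw [Measure.map_apply hm (hB'.prod (MeasurableSet.univ_pi hA')),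
      Measure.compProd_apply_prod hB' (MeasurableSet.univ_pi hA'),
      setLIntegral_map hB' (Kernel.measurable_coe _ (MeasurableSet.univ_pi hA')) hmo,
      ← lintegral_indicator_one (hm (hB'.prod (MeasurableSet.univ_pi hA'))),
      ← lintegral_indicator (hmo hB')]
    have hprod : ∀ f : Finset (Fin d) → ENNReal,
        ∏ s ∈ missComps G r, f s = ∏ s : missComps G r, f s.1 := fun f =>
      (Finset.prod_coe_sort _ f).symm
    simp_rw [hprod, hAA'] at key
    refine Eq.trans (lintegral_congr fun x => ?_) (key.trans (lintegral_congr fun x => ?_))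
    · by_cases hx : (observed r).restrict x ∈ B
      · by_cases hx' : ∀ s : missComps G r, s.1.restrict x ∈ A s
        · rw [Finset.prod_eq_one fun s _ => by simp [hx' s]]
          simp [Set.indicator, hx, hx', Set.mem_pi]
        · obtain ⟨s, hs⟩ := not_forall.1 hx'
          rw [Finset.prod_eq_zero (Finset.mem_univ s) (by simp [hs])]
          simp only [Set.indicator]
          simpa [hx] using ⟨s.1, s.2, hs⟩
      · simp [Set.indicator, hx]
    · by_cases hx : (observed r).restrict x ∈ B
      · have : piKernel μ G r ((observed r).restrict x) (Set.univ.pi A) =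
            ∏ s : missComps G r, compKernel μ G s.1 ((nbhd G s.1).restrict x) (A s) := by
          refine (Measure.pi_pi _ _).trans (Finset.prod_congr rfl fun s _ => ?_)
          rw [nbhd_restrict_extendZero s.2]
        simp [Set.indicator, hx, this]
      · simp [Set.indicator, hx]
  · rw [Measure.map_apply hm MeasurableSet.univ]
    simp [Measure.map_apply hmo MeasurableSet.univ]

/-- The conditional distribution of the missing variables given the observed ones is the product,
over the components, of the conditional distributions given the neighbours. -/
lemma condDistrib_missing_ae_eq {μ : Measure (Fin d → ℝ)} [IsFiniteMeasure μ]
    (h : ∀ s ∈ missComps G r, CondIndepOn μ s (closedNbhd G s)ᶜ (nbhd G s)) :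
    condDistrib (fun x : Fin d → ℝ => (missing r).restrict x)
        (fun x : Fin d → ℝ => (observed r).restrict x) μ
      =ᵐ[μ.map fun x => (observed r).restrict x] (piKernel μ G r).map (glue G r) := by
  have hmo := Finset.measurable_restrict (X := fun _ : Fin d => ℝ) (observed r)
  have hmm := Finset.measurable_restrict (X := fun _ : Fin d => ℝ) (missing r)
  have hmc : Measurable fun (x : Fin d → ℝ) (s : missComps G r) => s.1.restrict x :=
    measurable_pi_lambda _ fun s => Finset.measurable_restrict s.1
  have := Kernel.IsMarkovKernel.map (piKernel μ G r) (measurable_glue (G := G) (r := r))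
  refine condDistrib_ae_eq_of_measure_eq_compProd _ hmm.aemeasurable ?_
  rw [Measure.compProd_map measurable_glue, ← map_eq_compProd_piKernel h,
    Measure.map_map (measurable_id.prodMap measurable_glue) (hmo.prodMk hmc)]
  rfl

/-- Conditioning on an event about the response pattern does not change the law of the data, when
the data are missing completely at random. -/
lemma map_cond_eq_of_indepFun {Ω : Type*} [MeasurableSpace Ω] {P : Measure Ω}
    [IsProbabilityMeasure P] {X : Ω → Fin d → ℝ} {R : Ω → Pattern d} (hX : Measurable X)
    (hR : Measurable R) (h : IndepFun X R P) (S : Set (Pattern d)) (hS : P (R ⁻¹' S) ≠ 0) :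
    (P[|R ⁻¹' S]).map X = P.map X := by
  have hSm : MeasurableSet S := S.toFinite.measurableSet
  ext B hB
  rw [Measure.map_apply hX hB, Measure.map_apply hX hB, cond_apply (hR hSm), Set.inter_comm,
    (indepFun_iff_measure_inter_preimage_eq_mul.1 h) B S hB hSm, mul_comm, mul_assoc,
    ENNReal.mul_inv_cancel hS (measure_ne_top _ _), mul_one]

lemma condDistrib_comp_cond_eq {Ω : Type*} [MeasurableSpace Ω] {P Q : Measure Ω}
    [IsFiniteMeasure P] {X : Ω → Fin d → ℝ} [IsFiniteMeasure Q] (hX : Measurable X)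
    (h : Q.map X = P.map X) (s t : Finset (Fin d)) :
    condDistrib (fun ω => s.restrict (X ω)) (fun ω => t.restrict (X ω)) Q =
      condDistrib (fun x : Fin d → ℝ => s.restrict x) (fun x : Fin d → ℝ => t.restrict x)
        (P.map X) := by
  have hm : Measurable fun x : Fin d → ℝ => (t.restrict x, s.restrict x) := by fun_prop
  have hm' := Measure.map_map (μ := Q) hm hX
  rw [h] at hm'
  simp only [condDistrib]
  congr 1
  exact hm'.symm

lemma obsEvent_eq_preimage {Ω : Type*} (R : Ω → Pattern d) (T : Finset (Fin d)) :
    obsEvent R T = R ⁻¹' {p | ∀ v ∈ T, p v = true} := rfl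

/-- **Recovery of the imputation model**: under MCAR and the Markov property, the nonparametric
Markov missing graph model coincides almost everywhere with the extrapolation distribution and with
the conditional distribution in the whole population. -/
theorem npMMG_ae_eq {Ω : Type*} [MeasurableSpace Ω] {P : Measure Ω}
    [IsProbabilityMeasure P] {X : Ω → Fin d → ℝ} {R : Ω → Pattern d} (hX : Measurable X)
    (hR : Measurable R) (hMCAR : IndepFun X R P) (hfaith : Faithful G (P.map X))
    (hr : P (R ⁻¹' {r}) ≠ 0)
    (hs : ∀ s ∈ missComps G r, P (obsEvent R (closedNbhd G s)) ≠ 0) :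
    ∀ᵐ ω ∂P, npMMG P X R G r (X ω) = extrapolation P X R r (X ω) ∧
      npMMG P X R G r (X ω) = trueConditional P X r (X ω) := by
  have hmo := Finset.measurable_restrict (X := fun _ : Fin d => ℝ) (observed r)
  have hCI : ∀ s ∈ missComps G r, CondIndepOn (P.map X) s (closedNbhd G s)ᶜ (nbhd G s) := by
    intro s _
    refine (hfaith _ _ _ ?_ (disjoint_nbhd s) ?_).2 (separates_nbhd s)
    · exact Finset.disjoint_left.2 fun v hv hv' =>
        (Finset.mem_compl.1 hv') (Finset.mem_union_left _ hv)
    · exact Finset.disjoint_left.2 fun v hv hv' =>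
        (Finset.mem_compl.1 hv) (Finset.mem_union_right _ hv')
  have hnp : ∀ x, npMMG P X R G r x =
      (piKernel (P.map X) G r).map (glue G r) ((observed r).restrict x) := by
    intro x
    rw [Kernel.map_apply _ measurable_glue]
    unfold npMMG
    congr 1
    change _ = Measure.pi _
    congr 1
    funext s
    rw [nbhd_restrict_extendZero s.2, condDistrib_comp_cond_eq (P := P) hX]
    · rfl
    · rw [obsEvent_eq_preimage]
      exact map_cond_eq_of_indepFun hX hR hMCAR _ (hs s.1 s.2)
  have hext : ∀ x, extrapolation P X R r x = trueConditional P X r x := by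
    intro x
    unfold extrapolation trueConditional
    rw [condDistrib_comp_cond_eq (P := P) hX (map_cond_eq_of_indepFun hX hR hMCAR {r} hr),
      condDistrib_comp_cond_eq (P := P) hX rfl]
  have hae := ae_of_ae_map hX.aemeasurable
    (ae_of_ae_map hmo.aemeasurable (condDistrib_missing_ae_eq hCI))
  filter_upwards [hae] with ω hω
  rw [hext, and_self, hnp]
  unfold trueConditional
  rw [condDistrib_comp_cond_eq (P := P) hX rfl]
  exact hω.symm

end Recovery

/-! ### Maximum likelihood in the Gaussian model -/

section Likelihood

variable {ι : Type*} [Fintype ι] [DecidableEq ι]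

lemma log_det_eq_sum {M : Matrix ι ι ℝ} (hM : M.PosDef) :
    Real.log M.det = ∑ i, Real.log (hM.1.eigenvalues i) := by
  rw [hM.1.det_eq_prod_eigenvalues]
  exact Real.log_prod fun i _ => (hM.eigenvalues_pos i).ne'

lemma log_det_le_trace_sub_card {M : Matrix ι ι ℝ} (hM : M.PosDef) :
    Real.log M.det ≤ M.trace - Fintype.card ι := by
  have h : ∑ i, Real.log (hM.1.eigenvalues i) ≤ ∑ i, (hM.1.eigenvalues i - 1) :=
    Finset.sum_le_sum fun i _ => Real.log_le_sub_one_of_pos (hM.eigenvalues_pos i)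
  rw [log_det_eq_sum hM, hM.1.trace_eq_sum_eigenvalues]
  simpa using h

lemma eq_one_of_log_det_eq {M : Matrix ι ι ℝ} (hM : M.PosDef)
    (h : Real.log M.det = M.trace - Fintype.card ι) : M = 1 := by
  have hev : ∀ i, hM.1.eigenvalues i = 1 := by
    have h1 : ∑ i, Real.log (hM.1.eigenvalues i) = ∑ i, (hM.1.eigenvalues i - 1) := by
      rw [← log_det_eq_sum hM, h, hM.1.trace_eq_sum_eigenvalues]
      simp
    have h2 := (Finset.sum_eq_sum_iff_of_le fun i _ =>
      Real.log_le_sub_one_of_pos (hM.eigenvalues_pos i)).1 h1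
    intro i
    by_contra hi
    exact (Real.log_lt_sub_one_of_pos (hM.eigenvalues_pos i) hi).ne (h2 i (Finset.mem_univ i))
  have hdiag : Matrix.diagonal ((RCLike.ofReal : ℝ → ℝ) ∘ hM.1.eigenvalues) = 1 := by
    rw [← Matrix.diagonal_one]
    congr 1
    funext i
    simp [hev i]
  rw [hM.1.spectral_theorem, hdiag, map_one]

open scoped ComplexOrder MatrixOrder Matrix.Norms.L2Operator in
/-- The covariance part of the Gaussian risk with empirical covariance `S` is minimal at `S`,
and only there: with `S = yᴴ y`, the eigenvalues of `y Q⁻¹ yᴴ` satisfy `log λ ≤ λ - 1`, with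
equality only for `λ = 1`. -/
lemma log_det_add_trace_ge {S Q : Matrix ι ι ℝ} (hS : S.PosDef) (hQ : Q.PosDef) :
    Real.log S.det + Fintype.card ι ≤ Real.log Q.det + (Q⁻¹ * S).trace ∧
      (Real.log Q.det + (Q⁻¹ * S).trace ≤ Real.log S.det + Fintype.card ι → Q = S) := by
  obtain ⟨y, rfl⟩ := CStarAlgebra.nonneg_iff_eq_star_mul_self.mp hS.posSemidef.nonneg
  have hy : IsUnit y := by
    have := hS.isUnit
    rw [Matrix.isUnit_iff_isUnit_det, Matrix.det_mul] at this
    exact (Matrix.isUnit_iff_isUnit_det _).2 (isUnit_of_mul_isUnit_right this)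
  have hM : (y * Q⁻¹ * yᴴ).PosDef :=
    hQ.inv.mul_mul_conjTranspose_same (Matrix.vecMul_injective_iff_isUnit.2 hy)
  have hdet : Real.log (y * Q⁻¹ * yᴴ).det = Real.log (star y * y).det - Real.log Q.det := by
    have h1 : (y * Q⁻¹ * yᴴ).det = (star y * y).det * (Q.det)⁻¹ := by
      simp only [Matrix.det_mul, Matrix.det_nonsing_inv, Matrix.star_eq_conjTranspose,
        Ring.inverse_eq_inv']
      ring
    rw [h1, Real.log_mul hS.det_pos.ne' (inv_ne_zero hQ.det_pos.ne'), Real.log_inv]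
    ring
  have htr : (y * Q⁻¹ * yᴴ).trace = (Q⁻¹ * (star y * y)).trace := by
    rw [Matrix.mul_assoc, Matrix.trace_mul_comm, Matrix.mul_assoc, Matrix.star_eq_conjTranspose]
  have h := log_det_le_trace_sub_card hM
  refine ⟨by linarith, fun hle => ?_⟩
  have h1 : y * Q⁻¹ * yᴴ = 1 := eq_one_of_log_det_eq hM (by linarith)
  have hyd : IsUnit y.det := (Matrix.isUnit_iff_isUnit_det _).1 hy
  have hQd : IsUnit Q.det := hQ.det_pos.ne'.isUnit
  have h2 : Q⁻¹ * (yᴴ * y) = 1 := by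
    rw [← Matrix.mul_assoc, mul_eq_one_comm, ← Matrix.mul_assoc]
    exact h1
  calc Q = Q * (Q⁻¹ * (yᴴ * y)) := by rw [h2, Matrix.mul_one]
    _ = star y * y := by
      rw [← Matrix.mul_assoc, Matrix.mul_nonsing_inv _ hQd, Matrix.one_mul,
        Matrix.star_eq_conjTranspose]

/-- The mean of the vectors `y i`, `i ∈ I`. -/
noncomputable def sampleMean (I : Finset ℕ) (y : ℕ → ι → ℝ) : ι → ℝ :=
  fun u => (I.card : ℝ)⁻¹ * ∑ i ∈ I, y i u

/-- The covariance matrix of the vectors `y i`, `i ∈ I`, normalized by the number of vectors. -/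
noncomputable def sampleCov (I : Finset ℕ) (y : ℕ → ι → ℝ) : Matrix ι ι ℝ :=
  Matrix.of fun u v => (I.card : ℝ)⁻¹ *
    ∑ i ∈ I, (y i u - sampleMean I y u) * (y i v - sampleMean I y v)

omit [Fintype ι] [DecidableEq ι] in
lemma sum_sub_sampleMean {I : Finset ℕ} (hI : I.Nonempty) (y : ℕ → ι → ℝ) (u : ι) :
    ∑ i ∈ I, (y i u - sampleMean I y u) = 0 := by
  have : (I.card : ℝ) ≠ 0 := by exact_mod_cast hI.card_pos.ne'
  simp only [Finset.sum_sub_distrib, Finset.sum_const, sampleMean, nsmul_eq_mul]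
  field_simp
  ring

omit [Fintype ι] [DecidableEq ι] in
lemma sum_mul_sub_eq {I : Finset ℕ} (hI : I.Nonempty) (y : ℕ → ι → ℝ) (m : ι → ℝ) (u v : ι) :
    ∑ i ∈ I, (y i u - m u) * (y i v - m v) = I.card * (sampleCov I y u v +
      (sampleMean I y u - m u) * (sampleMean I y v - m v)) := by
  have hc : (I.card : ℝ) ≠ 0 := by exact_mod_cast hI.card_pos.ne'
  have h : ∀ i ∈ I, (y i u - m u) * (y i v - m v) =
      (y i u - sampleMean I y u) * (y i v - sampleMean I y v)
      + (sampleMean I y v - m v) * (y i u - sampleMean I y u)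
      + (sampleMean I y u - m u) * (y i v - sampleMean I y v)
      + (sampleMean I y u - m u) * (sampleMean I y v - m v) := fun i _ => by ring
  rw [Finset.sum_congr rfl h]
  simp only [Finset.sum_add_distrib, ← Finset.mul_sum, sum_sub_sampleMean hI, sampleCov,
    Matrix.of_apply, Finset.sum_const, nsmul_eq_mul]
  field_simp
  ring

omit [DecidableEq ι] in
lemma posSemidef_sampleCov (I : Finset ℕ) (y : ℕ → ι → ℝ) : (sampleCov I y).PosSemidef := by
  refine Matrix.PosSemidef.of_dotProduct_mulVec_nonneg ?_ fun x => ?_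
  · ext u v
    simp [sampleCov, mul_comm]
  · have : star x ⬝ᵥ (sampleCov I y *ᵥ x) =
        (I.card : ℝ)⁻¹ * ∑ i ∈ I, (∑ u, x u * (y i u - sampleMean I y u)) ^ 2 := by
      simp only [dotProduct, Matrix.mulVec, sampleCov, Matrix.of_apply, Pi.star_apply,
        star_trivial, sq, Finset.mul_sum, Finset.sum_mul]
      rw [Finset.sum_congr rfl fun u _ => Finset.sum_comm, Finset.sum_comm]
      refine Finset.sum_congr rfl fun i _ => Finset.sum_congr rfl fun u _ =>
        Finset.sum_congr rfl fun v _ => ?_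
      ring
    rw [this]
    positivity

/-- The Gaussian risk in terms of the sample mean and the sample covariance matrix. -/
lemma sum_gaussLoss_eq {I : Finset ℕ} (hI : I.Nonempty) (y : ℕ → ι → ℝ) (θ : GaussParam ι) :
    ∑ i ∈ I, gaussLoss θ (y i) = I.card / 2 * (Real.log θ.cov.det
      + (θ.cov⁻¹ * sampleCov I y).trace
      + (sampleMean I y - θ.mean) ⬝ᵥ (θ.cov⁻¹ *ᵥ (sampleMean I y - θ.mean))) := by
  have hquad : ∑ i ∈ I, (y i - θ.mean) ⬝ᵥ (θ.cov⁻¹ *ᵥ (y i - θ.mean)) =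
      I.card * ((θ.cov⁻¹ * sampleCov I y).trace
        + (sampleMean I y - θ.mean) ⬝ᵥ (θ.cov⁻¹ *ᵥ (sampleMean I y - θ.mean))) := by
    have h1 : ∀ x : ι → ℝ, x ⬝ᵥ (θ.cov⁻¹ *ᵥ x) = ∑ u, ∑ v, θ.cov⁻¹ u v * (x u * x v) := by
      intro x
      simp only [dotProduct, Matrix.mulVec, Finset.mul_sum]
      exact Finset.sum_congr rfl fun u _ => Finset.sum_congr rfl fun v _ => by ring
    have h2 : (θ.cov⁻¹ * sampleCov I y).trace =
        ∑ u, ∑ v, θ.cov⁻¹ u v * sampleCov I y u v := by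
      simp only [Matrix.trace, Matrix.diag, Matrix.mul_apply]
      refine Finset.sum_congr rfl fun u _ => Finset.sum_congr rfl fun v _ => ?_
      rw [← (posSemidef_sampleCov I y).1.apply u v]
      simp
    simp_rw [h1]
    rw [h2, ← Finset.sum_add_distrib, Finset.mul_sum, Finset.sum_comm]
    refine Finset.sum_congr rfl fun u _ => ?_
    rw [← Finset.sum_add_distrib, Finset.mul_sum, Finset.sum_comm]
    refine Finset.sum_congr rfl fun v _ => ?_
    simp only [Pi.sub_apply]
    rw [← Finset.mul_sum, sum_mul_sub_eq hI]
    ring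
  simp only [gaussLoss, Finset.sum_add_distrib, ← Finset.mul_sum, hquad, Finset.sum_const,
    nsmul_eq_mul]
  ring

/-- When the sample covariance matrix is nonsingular, the sample mean and the sample covariance
matrix are the unique maximum likelihood fit of the Gaussian model. -/
lemma sum_gaussLoss_sample_le {I : Finset ℕ} (hI : I.Nonempty) {y : ℕ → ι → ℝ}
    (hS : (sampleCov I y).PosDef) {θ : GaussParam ι} (hθ : θ.cov.PosDef) :
    ∑ i ∈ I, gaussLoss ⟨sampleMean I y, sampleCov I y⟩ (y i) ≤ ∑ i ∈ I, gaussLoss θ (y i) ∧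
    (∑ i ∈ I, gaussLoss θ (y i) ≤ ∑ i ∈ I, gaussLoss ⟨sampleMean I y, sampleCov I y⟩ (y i) →
      θ.mean = sampleMean I y ∧ θ.cov = sampleCov I y) := by
  have hc : (0 : ℝ) < I.card / 2 := by
    have : (0 : ℝ) < I.card := by exact_mod_cast hI.card_pos
    positivity
  obtain ⟨h1, h2⟩ := log_det_add_trace_ge hS hθ
  have h3 : 0 ≤ (sampleMean I y - θ.mean) ⬝ᵥ (θ.cov⁻¹ *ᵥ (sampleMean I y - θ.mean)) := by
    simpa using hθ.inv.posSemidef.dotProduct_mulVec_nonneg (sampleMean I y - θ.mean)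
  have h4 : ∑ i ∈ I, gaussLoss ⟨sampleMean I y, sampleCov I y⟩ (y i) =
      I.card / 2 * (Real.log (sampleCov I y).det + Fintype.card ι) := by
    rw [sum_gaussLoss_eq hI]
    simp [Matrix.nonsing_inv_mul _ hS.det_pos.ne'.isUnit]
  rw [h4, sum_gaussLoss_eq hI y θ]
  refine ⟨mul_le_mul_of_nonneg_left (by linarith) hc.le, fun h => ?_⟩
  have h5 := le_of_mul_le_mul_left h hc
  refine ⟨?_, h2 (by linarith)⟩
  by_contra hne
  have h6 : sampleMean I y - θ.mean ≠ 0 := sub_ne_zero.2 (Ne.symm hne)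
  have h7 : 0 < (sampleMean I y - θ.mean) ⬝ᵥ (θ.cov⁻¹ *ᵥ (sampleMean I y - θ.mean)) := by
    simpa using hθ.inv.dotProduct_mulVec_pos h6
  linarith

end Likelihood

section Fit

variable {d : ℕ} {G : SimpleGraph (Fin d)}

open Classical in
/-- The cases among the first `n` in which `s` and its neighbours are all observed. -/
noncomputable def fullCases (G : SimpleGraph (Fin d)) (s : Finset (Fin d)) (n : ℕ)
    (rs : ℕ → Pattern d) : Finset ℕ :=
  (Finset.range n).filter fun i => ∀ v ∈ closedNbhd G s, rs i v = true

lemma pos_of_fullCases_nonempty {s : Finset (Fin d)} {n : ℕ}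
    {r : ℕ → Pattern d} (h : (fullCases G s n r).Nonempty) : 0 < n := by
  obtain ⟨i, hi⟩ := h
  exact (Nat.zero_le i).trans_lt (Finset.mem_range.1 (Finset.mem_filter.1 hi).1)

lemma empRisk_eq (s : Finset (Fin d)) (n : ℕ) (xs : ℕ → Fin d → ℝ) (rs : ℕ → Pattern d)
    (θ : GaussParam (closedNbhd G s)) :
    empRisk G s n xs rs θ = (n : ℝ)⁻¹ *
      ∑ i ∈ fullCases G s n rs, gaussLoss θ ((closedNbhd G s).restrict (xs i)) := by
  classical
  simp only [empRisk, fullCases, Finset.sum_filter]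

/-- The Gaussian fit is the sample mean and covariance matrix of the full cases whenever the
latter is nonsingular. The sample covariance matrix of all variables, including the ones that need
not be observed in these cases, is used here: its submatrices are then nonsingular as well. -/
lemma IsGaussianFit.eq_sample {Ω : Type*} [MeasurableSpace Ω] {X : ℕ → Ω → Fin d → ℝ}
    {R : ℕ → Ω → Pattern d} {θ : ℕ → (s : Finset (Fin d)) → Ω → GaussParam (closedNbhd G s)}
    (hθ : IsGaussianFit G X R θ) {n : ℕ} {s : Finset (Fin d)} {ω : Ω}
    (hs : IsConnectedPattern G s) (hI : (fullCases G s n fun i => R i ω).Nonempty)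
    (hdet : (sampleCov (fullCases G s n fun i => R i ω) fun i => X i ω).PosDef) :
    (θ n s ω).mean = (closedNbhd G s).restrict
        (sampleMean (fullCases G s n fun i => R i ω) fun i => X i ω) ∧
      (θ n s ω).cov = (sampleCov (fullCases G s n fun i => R i ω) fun i => X i ω).submatrix
        (fun u : closedNbhd G s => u.1) (fun u => u.1) := by
  set I := fullCases G s n fun i => R i ω
  let y : ℕ → closedNbhd G s → ℝ := fun i => (closedNbhd G s).restrict (X i ω)
  have hcov : sampleCov I y = (sampleCov I fun i => X i ω).submatrix
      (fun u : closedNbhd G s => u.1) (fun u => u.1) := rfl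
  have hS : (sampleCov I y).PosDef := by
    rw [hcov]
    exact hdet.submatrix Subtype.val_injective
  have hn : (0 : ℝ) < n := by exact_mod_cast pos_of_fullCases_nonempty hI
  have hmin : IsRiskMin G s n (fun i => X i ω) (fun i => R i ω)
      ⟨sampleMean I y, sampleCov I y⟩ := by
    refine ⟨hS, fun θ' hθ' => ?_⟩
    rw [empRisk_eq, empRisk_eq]
    exact mul_le_mul_of_nonneg_left (sum_gaussLoss_sample_le hI hS hθ').1 (by positivity)
  obtain ⟨h1, h2⟩ := hθ.minimizes n s ω hs ⟨_, hmin⟩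
  have h3 := h2 ⟨sampleMean I y, sampleCov I y⟩ hS
  rw [empRisk_eq, empRisk_eq] at h3
  exact (sum_gaussLoss_sample_le hI hS h1).2 (le_of_mul_le_mul_left h3 (by positivity))

end Fit

/-! ### Asymptotically linear estimators -/

section Asymptotics

/-- A sequence that tends to zero almost surely, times one of bounded second moment, tends to zero
in probability. -/
lemma tendstoInMeasure_mul_zero {Ω : Type*} [MeasurableSpace Ω] {P : Measure Ω}
    [IsProbabilityMeasure P] {g S : ℕ → Ω → ℝ} (hg : ∀ n, AEMeasurable (g n) P)
    (hg0 : ∀ᵐ ω ∂P, Tendsto (fun n => g n ω) atTop (𝓝 0)) (hS : ∀ n, MemLp (S n) 2 P)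
    (hS0 : ∀ n, P[S n] = 0) {V : ℝ} (hV : ∀ n, Var[S n; P] ≤ V) :
    TendstoInMeasure P (fun n ω => g n ω * S n ω) atTop 0 := by
  have hgm : TendstoInMeasure P g atTop 0 :=
    tendstoInMeasure_of_tendsto_ae (fun n => (hg n).aestronglyMeasurable) hg0
  rw [tendstoInMeasure_iff_norm] at hgm ⊢
  intro ε hε
  rw [ENNReal.tendsto_nhds_zero]
  intro δ hδ
  -- `M` so large that `|S n| ≥ M` has probability at most `δ / 2` by Chebyshev's inequality
  obtain ⟨M, hM0, hM⟩ : ∃ M : ℝ, 0 < M ∧ ENNReal.ofReal (V / M ^ 2) ≤ δ / 2 := by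
    have h1 : Tendsto (fun M : ℝ => ENNReal.ofReal (V / M ^ 2)) atTop (𝓝 0) := by
      rw [← ENNReal.ofReal_zero]
      exact ENNReal.tendsto_ofReal (tendsto_const_nhds.div_atTop
        (tendsto_pow_atTop (by norm_num)))
    have h2 : ∀ᶠ M in atTop, ENNReal.ofReal (V / M ^ 2) ≤ δ / 2 :=
      (ENNReal.tendsto_nhds_zero.1 h1) _ (ENNReal.half_pos hδ.ne')
    obtain ⟨M, h3, h4⟩ := (h2.and (eventually_gt_atTop 0)).exists
    exact ⟨M, h4, h3⟩
  have h2 := (ENNReal.tendsto_nhds_zero.1 (hgm (ε / M) (by positivity))) _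
    (ENNReal.half_pos hδ.ne')
  filter_upwards [h2] with n hn
  have hsub : {ω | ε ≤ ‖g n ω * S n ω - (0 : Ω → ℝ) ω‖} ⊆
      {ω | ε / M ≤ ‖g n ω - (0 : Ω → ℝ) ω‖} ∪ {ω | M ≤ |S n ω - P[S n]|} := by
    intro ω hω
    by_contra hcon
    simp only [Set.mem_union, Set.mem_ofPred_eq, not_or, not_le, Pi.zero_apply, sub_zero, hS0,
      norm_mul, Real.norm_eq_abs] at hω hcon
    have : |g n ω| * |S n ω| < ε / M * M :=
      mul_lt_mul'' hcon.1 hcon.2 (abs_nonneg _) (abs_nonneg _)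
    rw [div_mul_cancel₀ _ hM0.ne'] at this
    linarith
  calc P {ω | ε ≤ ‖g n ω * S n ω - (0 : Ω → ℝ) ω‖}
      ≤ P {ω | ε / M ≤ ‖g n ω - (0 : Ω → ℝ) ω‖} + P {ω | M ≤ |S n ω - P[S n]|} :=
        (measure_mono hsub).trans (measure_union_le _ _)
    _ ≤ δ / 2 + δ / 2 := by
        refine add_le_add hn ((meas_ge_le_variance_div_sq (hS n) hM0).trans (le_trans ?_ hM))
        exact ENNReal.ofReal_le_ofReal (by gcongr; exact hV n)
    _ = δ := ENNReal.add_halves δ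

variable {E Ω Ω' : Type*} [MeasurableSpace E] [MeasurableSpace Ω] [MeasurableSpace Ω']
  {P : Measure Ω} [IsProbabilityMeasure P] {P' : Measure Ω'} [IsProbabilityMeasure P']
  {Y : Ω → E} {Y' : ℕ → Ω' → E}

omit [IsProbabilityMeasure P] [IsProbabilityMeasure P'] in
lemma ae_tendsto_average (hindep : iIndepFun Y' P') (hid : ∀ i, IdentDistrib (Y' i) Y P' P)
    {f : E → ℝ} (hf : Measurable f) (hint : Integrable (fun ω => f (Y ω)) P) :
    ∀ᵐ ω ∂P', Tendsto (fun n : ℕ => (n : ℝ)⁻¹ * ∑ i ∈ Finset.range n, f (Y' i ω)) atTop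
      (𝓝 (∫ ω, f (Y ω) ∂P)) := by
  have hid' : ∀ i, IdentDistrib (fun ω => f (Y' i ω)) (fun ω => f (Y ω)) P' P :=
    fun i => (hid i).comp hf
  have h := strong_law_ae (μ := P') (fun i ω => f (Y' i ω)) ((hid' 0).integrable_iff.2 hint)
    (fun i j hij => (hindep.indepFun hij).comp hf hf) (fun i => (hid' i).trans (hid' 0).symm)
  rw [(hid' 0).integral_eq] at h
  simpa [smul_eq_mul] using h

/-- **Delta method for random coefficients**: an estimator whose error is, for large samples, a
combination of averages of centered functions of the cases with consistent coefficients is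
asymptotically normal, with the variance given by the limits of the coefficients. -/
lemma hasAsympVar_of_expansion (hindep : iIndepFun Y' P')
    (hid : ∀ i, IdentDistrib (Y' i) Y P' P) {K : Type*} [Fintype K] {f : K → E → ℝ}
    (hf : ∀ k, Measurable (f k)) (hf2 : ∀ k, MemLp (fun ω => f k (Y ω)) 2 P)
    (hf0 : ∀ k, ∫ ω, f k (Y ω) ∂P = 0) {c : K → ℝ} {chat : ℕ → K → Ω' → ℝ}
    (hchat : ∀ n k, AEMeasurable (chat n k) P')
    (hc : ∀ k, ∀ᵐ ω ∂P', Tendsto (fun n => chat n k ω) atTop (𝓝 (c k)))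
    {T : ℕ → Ω' → ℝ} (hT : ∀ n, AEMeasurable (T n) P') {m : ℝ}
    (hexp : ∀ᵐ ω ∂P', ∀ᶠ n in atTop,
      T n ω - m = ∑ k, chat n k ω * ((n : ℝ)⁻¹ * ∑ i ∈ Finset.range n, f k (Y' i ω))) :
    HasAsympVar P' T m (Var[fun ω => ∑ k, c k * f k (Y ω); P]).toNNReal := by
  classical
  have hY' : ∀ i, AEMeasurable (Y' i) P' := fun i => (hid i).aemeasurable_fst
  have hidf : ∀ {h : E → ℝ}, Measurable h → ∀ i,
      IdentDistrib (fun ω => h (Y' i ω)) (fun ω => h (Y ω)) P' P := fun hh i => (hid i).comp hh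
  let φ : E → ℝ := fun y => ∑ k, c k * f k y
  have hφ : Measurable φ := Finset.measurable_fun_sum _ fun k _ => (hf k).const_mul _
  have hφ2 : MemLp (fun ω => φ (Y ω)) 2 P :=
    memLp_finsetSum _ fun k _ => (hf2 k).const_mul (c k)
  have hφ0 : ∫ ω, φ (Y ω) ∂P = 0 := by
    simp only [φ]
    rw [integral_finsetSum _ fun k _ => ((hf2 k).integrable (by norm_num)).const_mul _]
    simp [integral_const_mul, hf0]
  -- the normalized sums of the individual terms
  let S : ℕ → K → Ω' → ℝ := fun n k ω => (√(n : ℝ))⁻¹ * ∑ i ∈ Finset.range n, f k (Y' i ω)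
  have hf2' : ∀ i k, MemLp (fun ω => f k (Y' i ω)) 2 P' :=
    fun i k => (hidf (hf k) i).memLp_iff.2 (hf2 k)
  have hS2 : ∀ n k, MemLp (S n k) 2 P' := fun n k =>
    (memLp_finsetSum _ fun i _ => hf2' i k).const_mul _
  have hS0 : ∀ n k, P'[S n k] = 0 := by
    intro n k
    simp only [S]
    rw [integral_const_mul, integral_finsetSum _ fun i _ => (hf2' i k).integrable (by norm_num)]
    simp [(hidf (hf k) _).integral_eq, hf0]
  have hSV : ∀ n k, Var[S n k; P'] ≤ Var[fun ω => f k (Y ω); P] := by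
    intro n k
    simp only [S]
    rw [variance_const_mul]
    have h1 : Var[fun ω => ∑ i ∈ Finset.range n, f k (Y' i ω); P'] =
        n * Var[fun ω => f k (Y ω); P] := by
      have h2 := IndepFun.variance_sum (μ := P') (s := Finset.range n)
        (X := fun i ω => f k (Y' i ω)) (fun i _ => hf2' i k)
        (fun i _ j _ hij => (hindep.indepFun hij).comp (hf k) (hf k))
      have h3 : (∑ i ∈ Finset.range n, fun ω => f k (Y' i ω)) =
          fun ω => ∑ i ∈ Finset.range n, f k (Y' i ω) := by
        ext ω; simp
      rw [h3] at h2
      rw [h2]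
      simp [(hidf (hf k) _).variance_eq]
    rw [h1]
    rcases Nat.eq_zero_or_pos n with rfl | hn
    · simp [variance_nonneg]
    · have hn' : (0 : ℝ) < n := by exact_mod_cast hn
      rw [inv_pow, Real.sq_sqrt hn'.le, inv_mul_cancel_left₀ hn'.ne']
  -- the central limit theorem for the limiting combination
  have hCLT : TendstoInDistribution
      (fun (n : ℕ) ω => (√(n : ℝ))⁻¹ * ∑ i ∈ Finset.range n, φ (Y' i ω)) atTop (id : ℝ → ℝ)
      (fun _ => P') (gaussianReal 0 (Var[fun ω => φ (Y ω); P]).toNNReal) := by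
    have h0 : ∫ ω, φ (Y' 0 ω) ∂P' = 0 := by rw [(hidf hφ 0).integral_eq, hφ0]
    have := tendstoInDistribution_inv_sqrt_mul_sum_sub (P := P') (X := fun i ω => φ (Y' i ω))
      (P' := gaussianReal 0 (Var[fun ω => φ (Y ω); P]).toNNReal) (Y := id)
      (by rw [(hidf hφ 0).variance_eq]; exact HasLaw.id)
      ((hidf hφ 0).memLp_iff.2 hφ2) (hindep.comp (fun _ => φ) fun _ => hφ)
      (fun i => (hidf hφ i).trans (hidf hφ 0).symm)
    simpa [h0] using this
  -- adding the terms of the remainder one by one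
  have hadd : ∀ A : Finset K, TendstoInDistribution
      (fun (n : ℕ) ω => (√(n : ℝ))⁻¹ * ∑ i ∈ Finset.range n, φ (Y' i ω) +
        ∑ k ∈ A, (chat n k ω - c k) * S n k ω) atTop (id : ℝ → ℝ)
      (fun _ => P') (gaussianReal 0 (Var[fun ω => φ (Y ω); P]).toNNReal) := by
    intro A
    induction A using Finset.induction_on with
    | empty => simpa using hCLT
    | insert k A hk ih =>
      have hm : ∀ n, AEMeasurable (fun ω => (chat n k ω - c k) * S n k ω) P' := fun n =>
        ((hchat n k).sub_const _).mul (hS2 n k).aestronglyMeasurable.aemeasurable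
      have h := ih.add_of_tendstoInMeasure_const (c := 0)
        (tendstoInMeasure_mul_zero (V := Var[fun ω => f k (Y ω); P])
          (fun n => (hchat n k).sub_const (c k))
          (by filter_upwards [hc k] with ω hω
              simpa using hω.sub_const (c k)) (fun n => hS2 n k) (fun n => hS0 n k)
          (fun n => hSV n k)) hm
      refine (h.congr (fun n => ae_of_all _ fun ω => ?_) (ae_of_all _ fun ω => ?_))
      · simp only [Pi.add_apply, Finset.sum_insert hk]
        ring
      · simp
  have hlim := hadd Finset.univ
  refine tendstoInDistribution_of_tendstoInMeasure_sub _ _ hlim ?_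
    (fun n => ((hT n).sub_const _).const_mul _)
  refine tendstoInMeasure_of_tendsto_ae (fun n => ?_) ?_
  · exact (((hT n).sub_const _).const_mul _).aestronglyMeasurable.sub
      (hlim.forall_aemeasurable n).aestronglyMeasurable
  · filter_upwards [hexp] with ω hω
    refine tendsto_const_nhds.congr' ?_
    filter_upwards [hω, eventually_gt_atTop 0] with n hn hn0
    have hn' : (0 : ℝ) < n := by exact_mod_cast hn0
    have hs : √(n : ℝ) * (n : ℝ)⁻¹ = (√(n : ℝ))⁻¹ := by
      rw [← div_eq_mul_inv, Real.sqrt_div_self]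
    simp only [Pi.zero_apply, Pi.sub_apply, hn, S, φ]
    rw [Finset.sum_comm, Finset.mul_sum, Finset.mul_sum, ← Finset.sum_add_distrib,
      ← Finset.sum_sub_distrib]
    refine (Finset.sum_eq_zero fun k _ => ?_).symm
    rw [← Finset.mul_sum, ← hs]
    ring

end Asymptotics

/-! ### Regression coefficients -/

section Regression

lemma measurable_det_of_entries {Ω ι : Type*} [MeasurableSpace Ω] [Fintype ι] [DecidableEq ι]
    {A : Ω → Matrix ι ι ℝ} (hA : ∀ u v, Measurable fun ω => A ω u v) :
    Measurable fun ω => (A ω).det := by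
  simp only [Matrix.det_apply]
  exact Finset.measurable_fun_sum _ fun σ _ =>
    (Finset.measurable_fun_prod _ fun i _ => hA _ _).const_smul _

lemma measurable_inv_of_entries {Ω ι : Type*} [MeasurableSpace Ω] [Fintype ι] [DecidableEq ι]
    {A : Ω → Matrix ι ι ℝ} (hA : ∀ u v, Measurable fun ω => A ω u v) (u v : ι) :
    Measurable fun ω => (A ω)⁻¹ u v := by
  simp only [Matrix.inv_def, Matrix.smul_apply, Matrix.adjugate_apply, Ring.inverse_eq_inv',
    smul_eq_mul]
  refine (measurable_det_of_entries hA).inv.mul (measurable_det_of_entries fun a b => ?_)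
  by_cases h : a = v
  · subst h; simp
  · simpa [Matrix.updateRow_apply, h] using hA a b

variable {d : ℕ}

/-- The coefficients of the linear regression of the `j`-th variable on the variables in `N`, for
variables with covariance matrix `M`, extended by zero outside `N`. -/
noncomputable def regCoef (M : Matrix (Fin d) (Fin d) ℝ) (N : Finset (Fin d)) (j : Fin d) :
    Fin d → ℝ :=
  extendZero N ((fun v : N => M j v) ᵥ*
    (M.submatrix (fun v : N => (v : Fin d)) (fun v : N => (v : Fin d)))⁻¹)

lemma sum_extendZero_mul (N : Finset (Fin d)) (b : N → ℝ) (y : Fin d → ℝ) :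
    ∑ v, extendZero N b v * y v = ∑ u : N, b u * y u := by
  classical
  have h1 : ∑ u : N, b u * y u = ∑ u : N, extendZero N b u * y u := by
    refine Finset.sum_congr rfl fun u _ => ?_
    simp [extendZero]
  rw [h1, Finset.sum_coe_sort N fun v => extendZero N b v * y v]
  refine (Finset.sum_subset (Finset.subset_univ N) fun v _ hv => ?_).symm
  simp [extendZero, hv]

lemma regCoef_of_notMem {M : Matrix (Fin d) (Fin d) ℝ} {N : Finset (Fin d)} {j u : Fin d}
    (hu : u ∉ N) : regCoef M N j u = 0 := by
  simp [regCoef, extendZero, hu]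

/-- The normal equations. -/
lemma sum_regCoef_mul {M : Matrix (Fin d) (Fin d) ℝ} (hM : M.PosDef) {N : Finset (Fin d)}
    {j v : Fin d} (hv : v ∈ N) : ∑ u, regCoef M N j u * M u v = M j v := by
  have hB : (M.submatrix (fun v : N => (v : Fin d)) (fun v : N => (v : Fin d))).PosDef :=
    hM.submatrix Subtype.val_injective
  rw [regCoef, sum_extendZero_mul N _ fun u => M u v]
  have h : ((fun v : N => M j v) ᵥ*
      (M.submatrix (fun v : N => (v : Fin d)) (fun v : N => (v : Fin d)))⁻¹) ᵥ*
      (M.submatrix (fun v : N => (v : Fin d)) (fun v : N => (v : Fin d))) =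
      fun v : N => M j v := by
    rw [Matrix.vecMul_vecMul, Matrix.nonsing_inv_mul _ hB.det_pos.ne'.isUnit, Matrix.vecMul_one]
  exact congrFun h ⟨v, hv⟩

lemma measurable_regCoef {Ω : Type*} [MeasurableSpace Ω] {M : Ω → Matrix (Fin d) (Fin d) ℝ}
    (hM : ∀ u v, Measurable fun ω => M ω u v) (N : Finset (Fin d)) (j u : Fin d) :
    Measurable fun ω => regCoef (M ω) N j u := by
  by_cases hu : u ∈ N
  · simp only [regCoef, extendZero, hu, dite_true, Matrix.vecMul, dotProduct]
    exact Finset.measurable_fun_sum _ fun v _ =>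
      (hM _ _).mul (measurable_inv_of_entries (fun a b => hM _ _) _ _)
  · simp [regCoef_of_notMem hu]

lemma tendsto_regCoef {M : ℕ → Matrix (Fin d) (Fin d) ℝ} {Q : Matrix (Fin d) (Fin d) ℝ}
    (hQ : Q.PosDef) (h : ∀ u v, Tendsto (fun n => M n u v) atTop (𝓝 (Q u v)))
    (N : Finset (Fin d)) (j u : Fin d) :
    Tendsto (fun n => regCoef (M n) N j u) atTop (𝓝 (regCoef Q N j u)) := by
  by_cases hu : u ∈ N
  · have hB : (Q.submatrix (fun v : N => (v : Fin d)) (fun v : N => (v : Fin d))).PosDef :=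
      hQ.submatrix Subtype.val_injective
    have h1 : Tendsto (fun n => (M n).submatrix (fun v : N => (v : Fin d))
        (fun v : N => (v : Fin d))) atTop
        (𝓝 (Q.submatrix (fun v : N => (v : Fin d)) (fun v : N => (v : Fin d)))) :=
      tendsto_pi_nhds.2 fun a => tendsto_pi_nhds.2 fun b => h a b
    have h2 := (continuousAt_matrix_inv _ (by
      simpa [Ring.inverse_eq_inv'] using continuousAt_inv₀ hB.det_pos.ne')).tendsto.comp h1
    have h3 : ∀ a b, Tendsto (fun n => ((M n).submatrix (fun v : N => (v : Fin d))
        (fun v : N => (v : Fin d)))⁻¹ a b) atTop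
        (𝓝 ((Q.submatrix (fun v : N => (v : Fin d)) (fun v : N => (v : Fin d)))⁻¹ a b)) :=
      fun a b => (tendsto_pi_nhds.1 ((tendsto_pi_nhds.1 h2) a)) b
    simp only [regCoef, extendZero, hu, dite_true, Matrix.vecMul, dotProduct]
    exact tendsto_finsetSum _ fun v _ => (h _ _).mul (h3 _ _)
  · simp only [regCoef_of_notMem hu, tendsto_const_nhds]

/-- The conditional mean in a Gaussian model that is the restriction of a model for all variables,
in terms of regression coefficients. -/
lemma gaussCondMean_eq {G : SimpleGraph (Fin d)} {s : Finset (Fin d)} {j : Fin d}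
    (hj : j ∈ closedNbhd G s) {θ : GaussParam (closedNbhd G s)} {m : Fin d → ℝ}
    {M : Matrix (Fin d) (Fin d) ℝ} (hm : θ.mean = (closedNbhd G s).restrict m)
    (hM : θ.cov = M.submatrix (fun u : closedNbhd G s => u.1) (fun u => u.1)) (x : Fin d → ℝ) :
    gaussCondMean θ ⟨j, hj⟩ (Finset.univ.filter fun u => u.1 ∈ nbhd G s)
      ((closedNbhd G s).restrict x) = m j + ∑ u, regCoef M (nbhd G s) j u * (x u - m u) := by
  let N' : Finset (closedNbhd G s) := Finset.univ.filter fun u => u.1 ∈ nbhd G s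
  let e : N' ≃ nbhd G s :=
    { toFun := fun u => ⟨u.1.1, (Finset.mem_filter.1 u.2).2⟩
      invFun := fun u => ⟨⟨u.1, Finset.mem_union_right _ u.2⟩, by simp [N']⟩
      left_inv := fun u => rfl
      right_inv := fun u => rfl }
  let B := M.submatrix (fun v : nbhd G s => (v : Fin d)) (fun v : nbhd G s => (v : Fin d))
  have hB : θ.cov.submatrix (fun u : N' => (u : closedNbhd G s)) (fun u : N' => u) =
      B.submatrix e e := by
    rw [hM]; rfl
  unfold gaussCondMean
  change θ.mean _ + (fun u : N' => θ.cov _ _) ⬝ᵥ ((θ.cov.submatrix (fun u : N' =>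
    (u : closedNbhd G s)) (fun u : N' => u))⁻¹ *ᵥ fun u : N' => _) = _
  rw [hB, Matrix.inv_submatrix_equiv, regCoef, sum_extendZero_mul _ _ fun u => x u - m u,
    Matrix.dotProduct_mulVec, hm, hM]
  congr 1
  simp only [dotProduct]
  rw [← Equiv.sum_comp e]
  refine Finset.sum_congr rfl fun u _ => ?_
  congr 1
  simp only [Matrix.vecMul, dotProduct]
  rw [← Equiv.sum_comp e]
  rfl

lemma measurable_gaussCondMean {Ω ι : Type*} [MeasurableSpace Ω] [DecidableEq ι]
    {θ : Ω → GaussParam ι} (hm : ∀ u, Measurable fun ω => (θ ω).mean u)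
    (hc : ∀ u v, Measurable fun ω => (θ ω).cov u v) (a : ι) (N : Finset ι) {x : Ω → ι → ℝ}
    (hx : ∀ u, Measurable fun ω => x ω u) :
    Measurable fun ω => gaussCondMean (θ ω) a N (x ω) := by
  simp only [gaussCondMean, dotProduct, Matrix.mulVec]
  exact (hm a).add (Finset.measurable_fun_sum _ fun u _ => (hc _ _).mul
    (Finset.measurable_fun_sum _ fun v _ =>
      (measurable_inv_of_entries (fun b c => hc _ _) _ _).mul ((hx _).sub (hm _))))

end Regression

/-! ### Expansion of the estimators -/

section Expansion

variable {d : ℕ}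

/-- A case: its data and its response pattern. -/
abbrev Case (d : ℕ) : Type := (Fin d → ℝ) × Pattern d

/-- The average of `f` over the first `n` cases. -/
noncomputable def average (n : ℕ) (f : Case d → ℝ) (y : ℕ → Case d) : ℝ :=
  (n : ℝ)⁻¹ * ∑ i ∈ Finset.range n, f (y i)

open Classical in
/-- The indicator that all variables in `T` are observed. -/
noncomputable def fullInd (T : Finset (Fin d)) (p : Pattern d) : ℝ :=
  if ∀ v ∈ T, p v = true then 1 else 0

/-- The indicator that `j` is missing and that `s` is its component of missing variables. -/
noncomputable def compInd (G : SimpleGraph (Fin d)) (j : Fin d) (s : Finset (Fin d))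
    (p : Pattern d) : ℝ :=
  if p j = false ∧ missComp G p j = s then 1 else 0

/-- The mean of the `u`-th variable, centered at `m`, over the cases in which `T` is observed. -/
noncomputable def fullMean (T : Finset (Fin d)) (m : Fin d → ℝ) (n : ℕ) (y : ℕ → Case d)
    (u : Fin d) : ℝ :=
  average n (fun c => fullInd T c.2 * (c.1 u - m u)) y / average n (fun c => fullInd T c.2) y

/-- The sample covariance matrix of the cases in which `T` is observed, in terms of averages of
variables centered at an arbitrary `m`. -/
noncomputable def fullCov (T : Finset (Fin d)) (m : Fin d → ℝ) (n : ℕ) (y : ℕ → Case d) :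
    Matrix (Fin d) (Fin d) ℝ :=
  Matrix.of fun u v =>
    average n (fun c => fullInd T c.2 * ((c.1 u - m u) * (c.1 v - m v))) y /
      average n (fun c => fullInd T c.2) y - fullMean T m n y u * fullMean T m n y v

lemma average_fullInd_mul (G : SimpleGraph (Fin d)) (s : Finset (Fin d)) (n : ℕ)
    (y : ℕ → Case d) (g : (Fin d → ℝ) → ℝ) :
    average n (fun c => fullInd (closedNbhd G s) c.2 * g c.1) y =
      (n : ℝ)⁻¹ * ∑ i ∈ fullCases G s n (fun i => (y i).2), g (y i).1 := by
  simp [average, fullInd, fullCases, Finset.sum_filter]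

lemma average_fullInd (G : SimpleGraph (Fin d)) (s : Finset (Fin d)) (n : ℕ) (y : ℕ → Case d) :
    average n (fun c => fullInd (closedNbhd G s) c.2) y =
      (n : ℝ)⁻¹ * (fullCases G s n fun i => (y i).2).card := by
  simpa using average_fullInd_mul G s n y fun _ => 1

lemma sampleMean_fullCases {G : SimpleGraph (Fin d)} {s : Finset (Fin d)} {n : ℕ}
    {y : ℕ → Case d} (h : (fullCases G s n fun i => (y i).2).Nonempty) (m : Fin d → ℝ)
    (u : Fin d) :
    sampleMean (fullCases G s n fun i => (y i).2) (fun i => (y i).1) u =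
      m u + fullMean (closedNbhd G s) m n y u := by
  have hn : (n : ℝ) ≠ 0 := by exact_mod_cast (pos_of_fullCases_nonempty h).ne'
  have hc : ((fullCases G s n fun i => (y i).2).card : ℝ) ≠ 0 := by exact_mod_cast h.card_pos.ne'
  rw [fullMean, average_fullInd_mul G s n y fun x => x u - m u, average_fullInd, sampleMean]
  simp only [Finset.sum_sub_distrib, Finset.sum_const, nsmul_eq_mul]
  field_simp
  ring

lemma sampleCov_fullCases {G : SimpleGraph (Fin d)} {s : Finset (Fin d)} {n : ℕ}
    {y : ℕ → Case d} (h : (fullCases G s n fun i => (y i).2).Nonempty) (m : Fin d → ℝ) :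
    sampleCov (fullCases G s n fun i => (y i).2) (fun i => (y i).1) =
      fullCov (closedNbhd G s) m n y := by
  have hn : (n : ℝ) ≠ 0 := by exact_mod_cast (pos_of_fullCases_nonempty h).ne'
  have hc : ((fullCases G s n fun i => (y i).2).card : ℝ) ≠ 0 := by exact_mod_cast h.card_pos.ne'
  ext u v
  rw [fullCov, Matrix.of_apply,
    average_fullInd_mul G s n y fun x => (x u - m u) * (x v - m v), average_fullInd,
    sum_mul_sub_eq h (fun i => (y i).1) m u v, sampleMean_fullCases h m,
    sampleMean_fullCases h m]
  field_simp
  ring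

/-- The indices of the terms in the expansion of the Gaussian Markov missing graph estimator. -/
abbrev TermIndex (𝒮 : Finset (Finset (Fin d))) : Type := Option (𝒮 × Fin d × Bool)

/-- The centered functions of a case of which averages appear in the expansion of the Gaussian
Markov missing graph estimator. -/
noncomputable def term (G : SimpleGraph (Fin d)) (j : Fin d) (m : Fin d → ℝ)
    {𝒮 : Finset (Finset (Fin d))} : TermIndex 𝒮 → Case d → ℝ
  | none => fun c => fullInd {j} c.2 * (c.1 j - m j)
  | some (s, u, true) => fun c => compInd G j s c.2 * (c.1 u - m u)
  | some (s, u, false) => fun c => fullInd (closedNbhd G s.1) c.2 * (c.1 u - m u)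

/-- The coefficients of the terms in the expansion: `b s` are the coefficients of the regression of
`j` on the neighbours of `s`, and `p s` is the ratio of the frequency of `s` as the component of `j`
to the frequency of the cases that enter the fit for `s`. -/
noncomputable def termCoef (j : Fin d) {𝒮 : Finset (Finset (Fin d))}
    (b : Finset (Fin d) → Fin d → ℝ) (p : Finset (Fin d) → ℝ) : TermIndex 𝒮 → ℝ
  | none => 1
  | some (s, u, true) => b s u
  | some (s, u, false) => p s * ((if u = j then 1 else 0) - b s u)

lemma sum_termIndex {𝒮 : Finset (Finset (Fin d))} (F : TermIndex 𝒮 → ℝ) :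
    ∑ k, F k = F none + ∑ s : 𝒮, ∑ u, (F (some (s, u, true)) + F (some (s, u, false))) := by
  simp [Fintype.sum_option, Fintype.sum_prod_type]

lemma average_add (n : ℕ) (f g : Case d → ℝ) (y : ℕ → Case d) :
    average n (fun c => f c + g c) y = average n f y + average n g y := by
  simp [average, Finset.sum_add_distrib, mul_add]

lemma average_mul_const (n : ℕ) (f : Case d → ℝ) (y : ℕ → Case d) (a : ℝ) :
    average n (fun c => f c * a) y = average n f y * a := by
  simp [average, Finset.sum_mul, mul_assoc]

lemma average_sum {κ : Type*} (A : Finset κ) (n : ℕ) (f : κ → Case d → ℝ) (y : ℕ → Case d) :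
    average n (fun c => ∑ k ∈ A, f k c) y = ∑ k ∈ A, average n (f k) y := by
  simp only [average]
  rw [Finset.sum_comm, Finset.mul_sum]

/-- The error of the imputed value of variable `j`, when the Gaussian models are fitted by sample
means and covariance matrices. -/
lemma imputed_sub_eq {G : SimpleGraph (Fin d)} {j : Fin d} {m : Fin d → ℝ}
    {𝒮 : Finset (Finset (Fin d))} {θ : (s : Finset (Fin d)) → GaussParam (closedNbhd G s)}
    {δ : Finset (Fin d) → Fin d → ℝ} {M : Finset (Fin d) → Matrix (Fin d) (Fin d) ℝ}
    (hθ : ∀ s ∈ 𝒮, (θ s).mean = (closedNbhd G s).restrict (fun u => m u + δ s u) ∧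
      (θ s).cov = (M s).submatrix (fun u : closedNbhd G s => u.1) (fun u => u.1))
    (x : Fin d → ℝ) (r : Pattern d) (hr : r j = false → missComp G r j ∈ 𝒮) :
    imputed G θ j x r - m j = fullInd {j} r * (x j - m j) + ∑ s ∈ 𝒮, compInd G j s r *
      (δ s j + ∑ u, regCoef (M s) (nbhd G s) j u * (x u - m u - δ s u)) := by
  classical
  by_cases hj : r j = false
  · have hmem := hr hj
    obtain ⟨h1, h2⟩ := hθ _ hmem
    rw [Finset.sum_eq_single (missComp G r j)]
    · simp only [imputed, hj, dite_true, fullInd, compInd, and_self, if_true]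
      rw [gaussCondMean_eq (mem_closedNbhd_missComp G hj) h1 h2]
      simp [sub_sub, hj]
      ring
    · intro s _ hs
      simp [compInd, hs.symm]
    · exact fun h => absurd hmem h
  · have hj' : r j = true := by simpa using hj
    simp [imputed, fullInd, compInd, hj']

/-- Expansion of the Gaussian Markov missing graph estimator as a combination of averages of
centered functions of the cases. -/
lemma gmmgEstimator_sub_eq {G : SimpleGraph (Fin d)} {j : Fin d} {m : Fin d → ℝ}
    {𝒮 : Finset (Finset (Fin d))} {θ : (s : Finset (Fin d)) → GaussParam (closedNbhd G s)}
    {M : Finset (Fin d) → Matrix (Fin d) (Fin d) ℝ} {n : ℕ} (hn : 0 < n) {y : ℕ → Case d}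
    (hθ : ∀ s ∈ 𝒮, (θ s).mean = (closedNbhd G s).restrict
        (fun u => m u + fullMean (closedNbhd G s) m n y u) ∧
      (θ s).cov = (M s).submatrix (fun u : closedNbhd G s => u.1) (fun u => u.1))
    (hr : ∀ i, (y i).2 j = false → missComp G (y i).2 j ∈ 𝒮) :
    gmmgEstimator G θ j n (fun i => (y i).1) (fun i => (y i).2) - m j =
      ∑ k : TermIndex 𝒮, termCoef j (fun s => regCoef (M s) (nbhd G s) j)
        (fun s => average n (fun c => compInd G j s c.2) y /
          average n (fun c => fullInd (closedNbhd G s) c.2) y) k * average n (term G j m k) y := by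
  have hn' : (n : ℝ) ≠ 0 := by exact_mod_cast hn.ne'
  have h1 : gmmgEstimator G θ j n (fun i => (y i).1) (fun i => (y i).2) - m j =
      average n (fun c => fullInd {j} c.2 * (c.1 j - m j) + ∑ s ∈ 𝒮, compInd G j s c.2 *
        (fullMean (closedNbhd G s) m n y j + ∑ u, regCoef (M s) (nbhd G s) j u *
          (c.1 u - m u - fullMean (closedNbhd G s) m n y u))) y := by
    simp only [gmmgEstimator, average]
    rw [← Finset.sum_congr rfl fun i _ => imputed_sub_eq hθ (y i).1 (y i).2 (hr i)]
    simp only [Finset.sum_sub_distrib, Finset.sum_const, Finset.card_range, nsmul_eq_mul]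
    field_simp
  rw [h1, average_add, average_sum, sum_termIndex]
  have h2 : ∀ s, average n (fun c => compInd G j s c.2 *
        (fullMean (closedNbhd G s) m n y j + ∑ u, regCoef (M s) (nbhd G s) j u *
          (c.1 u - m u - fullMean (closedNbhd G s) m n y u))) y =
      average n (fun c => compInd G j s c.2) y * fullMean (closedNbhd G s) m n y j +
        ∑ u, regCoef (M s) (nbhd G s) j u *
          (average n (fun c => compInd G j s c.2 * (c.1 u - m u)) y -
            average n (fun c => compInd G j s c.2) y * fullMean (closedNbhd G s) m n y u) := by
    intro s
    have h3 : ∀ c : Case d, compInd G j s c.2 *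
        (fullMean (closedNbhd G s) m n y j + ∑ u, regCoef (M s) (nbhd G s) j u *
          (c.1 u - m u - fullMean (closedNbhd G s) m n y u)) =
        compInd G j s c.2 * fullMean (closedNbhd G s) m n y j +
          ∑ u, (compInd G j s c.2 * (c.1 u - m u) * regCoef (M s) (nbhd G s) j u +
            compInd G j s c.2 *
              -(regCoef (M s) (nbhd G s) j u * fullMean (closedNbhd G s) m n y u)) := by
      intro c
      rw [mul_add, Finset.mul_sum]
      congr 1
      exact Finset.sum_congr rfl fun u _ => by ring
    simp_rw [h3]
    rw [average_add, average_mul_const, average_sum]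
    congr 1
    refine Finset.sum_congr rfl fun u _ => ?_
    rw [average_add, average_mul_const, average_mul_const]
    ring
  congr 1
  · simp [termCoef, term]
  · rw [← Finset.sum_coe_sort]
    refine Finset.sum_congr rfl fun s _ => ?_
    rw [h2]
    simp only [termCoef, term]
    have h4 : ∀ u, average n (fun c => fullInd (closedNbhd G s.1) c.2 * (c.1 u - m u)) y /
        average n (fun c => fullInd (closedNbhd G s.1) c.2) y =
          fullMean (closedNbhd G s.1) m n y u := fun u => rfl
    have h5 : ∀ u, average n (fun c => compInd G j s.1 c.2) y /
          average n (fun c => fullInd (closedNbhd G s.1) c.2) y *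
          ((if u = j then 1 else 0) - regCoef (M s) (nbhd G s) j u) *
        average n (fun c => fullInd (closedNbhd G s.1) c.2 * (c.1 u - m u)) y =
        (if u = j then average n (fun c => compInd G j s.1 c.2) y *
          fullMean (closedNbhd G s.1) m n y u else 0) -
        regCoef (M s) (nbhd G s) j u * (average n (fun c => compInd G j s.1 c.2) y *
          fullMean (closedNbhd G s.1) m n y u) := by
      intro u
      rw [← h4]
      split_ifs <;> ring
    rw [Finset.sum_add_distrib, Finset.sum_congr rfl fun u _ => h5 u, Finset.sum_sub_distrib,
      Finset.sum_ite_eq' Finset.univ j, if_pos (Finset.mem_univ j),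
      Finset.sum_congr rfl fun u _ => mul_sub (regCoef (M s) (nbhd G s) j u) _ _,
      Finset.sum_sub_distrib]
    ring

open Classical in
/-- Expansion of the complete-case estimator. -/
lemma ccEstimator_sub_eq {j : Fin d} {m : Fin d → ℝ} {n : ℕ} {y : ℕ → Case d}
    (h : average n (fun c => fullInd Finset.univ c.2) y ≠ 0) :
    ccEstimator j n (fun i => (y i).1) (fun i => (y i).2) - m j =
      (average n (fun c => fullInd Finset.univ c.2) y)⁻¹ *
        average n (fun c => fullInd Finset.univ c.2 * (c.1 j - m j)) y := by
  have hn : (n : ℝ) ≠ 0 := fun h0 => h (by simp [average, h0])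
  have hs : ∑ i ∈ Finset.range n, fullInd Finset.univ (y i).2 ≠ 0 := fun h0 =>
    h (by simp [average, h0])
  have h1 : ccEstimator j n (fun i => (y i).1) (fun i => (y i).2) =
      (∑ i ∈ Finset.range n, fullInd Finset.univ (y i).2 * (y i).1 j) /
        ∑ i ∈ Finset.range n, fullInd Finset.univ (y i).2 := by
    simp [ccEstimator, fullInd]
  rw [h1]
  simp only [average, mul_sub, Finset.sum_sub_distrib, ← Finset.sum_mul]
  field_simp

end Expansion

/-! ### Asymptotic normality -/

section Population

variable {d : ℕ} {Ω : Type*} [MeasurableSpace Ω]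

/-- The conditions under which the estimators are asymptotically normal, Gaussian or not:
square integrable data with nonsingular covariance matrix, missing completely at random, with
complete cases of positive probability. -/
structure RegularMCAR (P : Measure Ω) (X : Ω → Fin d → ℝ) (R : Ω → Pattern d) : Prop where
  measurable_data : Measurable X
  measurable_pattern : Measurable R
  indep : IndepFun X R P
  memLp : ∀ u, MemLp (fun ω => X ω u) 2 P
  posDef : (Matrix.of fun u v => cov[fun ω => X ω u, fun ω => X ω v; P]).PosDef
  complete : P {ω | ∀ v, R ω v = true} ≠ 0

/-- The mean vector. -/
noncomputable def meanVec (P : Measure Ω) (X : Ω → Fin d → ℝ) (u : Fin d) : ℝ := ∫ ω, X ω u ∂P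

/-- The covariance matrix. -/
noncomputable def covMat (P : Measure Ω) (X : Ω → Fin d → ℝ) : Matrix (Fin d) (Fin d) ℝ :=
  Matrix.of fun u v => cov[fun ω => X ω u, fun ω => X ω v; P]

/-- The probability that all variables in `T` are observed. -/
noncomputable def obsProb (P : Measure Ω) (R : Ω → Pattern d) (T : Finset (Fin d)) : ℝ :=
  ∫ ω, fullInd T (R ω) ∂P

/-- The probability that `j` is missing with `s` as its component of missing variables. -/
noncomputable def compProb (P : Measure Ω) (R : Ω → Pattern d) (G : SimpleGraph (Fin d))
    (j : Fin d) (s : Finset (Fin d)) : ℝ :=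
  ∫ ω, compInd G j s (R ω) ∂P

open Classical in
/-- The components of `j` among the missing variables, for the patterns of positive probability
under which `j` is missing. -/
noncomputable def compSet (P : Measure Ω) (R : Ω → Pattern d) (G : SimpleGraph (Fin d))
    (j : Fin d) : Finset (Finset (Fin d)) :=
  (Finset.univ.filter fun r : Pattern d => r j = false ∧ P (R ⁻¹' {r}) ≠ 0).image
    fun r => missComp G r j

/-- The limits of the coefficients in the expansion of the Gaussian Markov missing graph
estimator. -/
noncomputable def limitCoef (P : Measure Ω) (X : Ω → Fin d → ℝ) (R : Ω → Pattern d)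
    (G : SimpleGraph (Fin d)) (j : Fin d) : TermIndex (compSet P R G j) → ℝ :=
  termCoef j (fun s => regCoef (covMat P X) (nbhd G s) j)
    fun s => compProb P R G j s / obsProb P R (closedNbhd G s)

/-- The influence function of the Gaussian Markov missing graph estimator. -/
noncomputable def gmmgInfluence (P : Measure Ω) (X : Ω → Fin d → ℝ) (R : Ω → Pattern d)
    (G : SimpleGraph (Fin d)) (j : Fin d) (ω : Ω) : ℝ :=
  ∑ k, limitCoef P X R G j k * term G j (meanVec P X) k (X ω, R ω)

/-- The influence function of the complete-case estimator. -/
noncomputable def ccInfluence (P : Measure Ω) (X : Ω → Fin d → ℝ) (R : Ω → Pattern d)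
    (j : Fin d) (ω : Ω) : ℝ :=
  (obsProb P R Finset.univ)⁻¹ * (fullInd Finset.univ (R ω) * (X ω j - meanVec P X j))

lemma fullInd_nonneg (T : Finset (Fin d)) (p : Pattern d) : 0 ≤ fullInd T p := by
  unfold fullInd; split_ifs <;> norm_num

lemma fullInd_le_one (T : Finset (Fin d)) (p : Pattern d) : fullInd T p ≤ 1 := by
  unfold fullInd; split_ifs <;> norm_num

lemma compInd_nonneg (G : SimpleGraph (Fin d)) (j : Fin d) (s : Finset (Fin d)) (p : Pattern d) :
    0 ≤ compInd G j s p := by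
  unfold compInd; split_ifs <;> norm_num

lemma measurable_pattern_fun {β : Type*} [MeasurableSpace β] (g : Pattern d → β) :
    Measurable g := .of_discrete

namespace RegularMCAR

variable {P : Measure Ω} [IsProbabilityMeasure P] {X : Ω → Fin d → ℝ} {R : Ω → Pattern d}
  (h : RegularMCAR P X R)

include h

omit [IsProbabilityMeasure P] in
lemma integral_mul (g : Pattern d → ℝ) {f : (Fin d → ℝ) → ℝ} (hf : Measurable f) :
    ∫ ω, g (R ω) * f (X ω) ∂P = (∫ ω, g (R ω) ∂P) * ∫ ω, f (X ω) ∂P :=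
  h.indep.symm.integral_fun_comp_mul_comp h.measurable_pattern.aemeasurable
    h.measurable_data.aemeasurable (measurable_pattern_fun g).aestronglyMeasurable
    hf.aestronglyMeasurable

lemma memLp_center (u : Fin d) : MemLp (fun ω => X ω u - meanVec P X u) 2 P :=
  (h.memLp u).sub (memLp_const _)

lemma integral_center (u : Fin d) : ∫ ω, (X ω u - meanVec P X u) ∂P = 0 := by
  rw [integral_sub ((h.memLp u).integrable (by norm_num)) (integrable_const _)]
  simp [meanVec]

lemma integrable_center_mul (u v : Fin d) :
    Integrable (fun ω => (X ω u - meanVec P X u) * (X ω v - meanVec P X v)) P :=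
  (h.memLp_center u).integrable_mul (h.memLp_center v)

omit [IsProbabilityMeasure P] h in
lemma integral_center_mul (u v : Fin d) :
    ∫ ω, (X ω u - meanVec P X u) * (X ω v - meanVec P X v) ∂P = covMat P X u v := rfl

omit [IsProbabilityMeasure P] in
/-- Multiplication by a function of the pattern, which is bounded, preserves `L^p`. -/
lemma memLp_mul (g : Pattern d → ℝ) {f : Ω → ℝ} {p : ENNReal} (hf : MemLp f p P) :
    MemLp (fun ω => g (R ω) * f ω) p P := by
  obtain ⟨C, hC⟩ := (Set.finite_range fun r => ‖g r‖).bddAbove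
  refine MemLp.of_le_mul (c := C) hf (((measurable_pattern_fun g).comp
    h.measurable_pattern).aestronglyMeasurable.mul hf.1) (ae_of_all _ fun ω => ?_)
  rw [norm_mul]
  exact mul_le_mul_of_nonneg_right (hC ⟨R ω, rfl⟩) (norm_nonneg _)

omit [IsProbabilityMeasure P] in
lemma integrable_mul (g : Pattern d → ℝ) {f : Ω → ℝ} (hf : Integrable f P) :
    Integrable (fun ω => g (R ω) * f ω) P :=
  memLp_one_iff_integrable.1 (h.memLp_mul g (memLp_one_iff_integrable.2 hf))

lemma integrable_pattern (g : Pattern d → ℝ) : Integrable (fun ω => g (R ω)) P := by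
  simpa using h.integrable_mul g (integrable_const (1 : ℝ))

lemma obsProb_univ_pos : 0 < obsProb P R Finset.univ := by
  classical
  have hm : MeasurableSet {ω | ∀ v, R ω v = true} :=
    h.measurable_pattern (Set.toFinite {p : Pattern d | ∀ v, p v = true}).measurableSet
  have : obsProb P R Finset.univ = P.real {ω | ∀ v, R ω v = true} := by
    rw [← integral_indicator_one hm, obsProb]
    refine integral_congr_ae (ae_of_all _ fun ω => ?_)
    simp [fullInd, Set.indicator]
  rw [this]
  exact ENNReal.toReal_pos h.complete (measure_ne_top _ _)

lemma obsProb_univ_le (T : Finset (Fin d)) : obsProb P R Finset.univ ≤ obsProb P R T := by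
  refine integral_mono (h.integrable_pattern _) (h.integrable_pattern _) fun ω => ?_
  simp only [fullInd]
  by_cases h1 : ∀ v ∈ (Finset.univ : Finset (Fin d)), R ω v = true
  · have h2 : ∀ v ∈ T, R ω v = true := fun v _ => h1 v (Finset.mem_univ v)
    rw [if_pos h1, if_pos h2]
  · rw [if_neg h1]
    split_ifs <;> norm_num

lemma obsProb_pos (T : Finset (Fin d)) : 0 < obsProb P R T :=
  h.obsProb_univ_pos.trans_le (h.obsProb_univ_le T)

variable {G : SimpleGraph (Fin d)} {j : Fin d}

lemma memLp_term {𝒮 : Finset (Finset (Fin d))} (k : TermIndex 𝒮) :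
    MemLp (fun ω => term G j (meanVec P X) k (X ω, R ω)) 2 P := by
  match k with
  | none => exact h.memLp_mul _ (h.memLp_center j)
  | some (s, u, true) => exact h.memLp_mul (fun r => compInd G j s r) (h.memLp_center u)
  | some (s, u, false) =>
    exact h.memLp_mul (fun r => fullInd (closedNbhd G s.1) r) (h.memLp_center u)

lemma integral_mul_center (g : Pattern d → ℝ) (u : Fin d) :
    ∫ ω, g (R ω) * (X ω u - meanVec P X u) ∂P = 0 := by
  have := h.integral_mul g (f := fun x => x u - meanVec P X u) (by fun_prop)
  rw [this, h.integral_center, mul_zero]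

lemma integral_term {𝒮 : Finset (Finset (Fin d))} (k : TermIndex 𝒮) :
    ∫ ω, term G j (meanVec P X) k (X ω, R ω) ∂P = 0 := by
  match k with
  | none => exact h.integral_mul_center (fun r => fullInd {j} r) j
  | some (s, u, true) => exact h.integral_mul_center (fun r => compInd G j s r) u
  | some (s, u, false) =>
    exact h.integral_mul_center (fun r => fullInd (closedNbhd G s.1) r) u

end RegularMCAR

lemma measurable_case (g : Pattern d → ℝ) {f : (Fin d → ℝ) → ℝ} (hf : Measurable f) :
    Measurable fun c : Case d => g c.2 * f c.1 :=
  ((measurable_pattern_fun g).comp measurable_snd).mul (hf.comp measurable_fst)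

lemma measurable_term {G : SimpleGraph (Fin d)} {j : Fin d} {m : Fin d → ℝ}
    {𝒮 : Finset (Finset (Fin d))} (k : TermIndex 𝒮) : Measurable (term G j m k) := by
  match k with
  | none => exact measurable_case (fullInd {j}) (f := fun x => x j - m j) (by fun_prop)
  | some (s, u, true) =>
    exact measurable_case (compInd G j s) (f := fun x => x u - m u) (by fun_prop)
  | some (s, u, false) =>
    exact measurable_case (fullInd (closedNbhd G s.1)) (f := fun x => x u - m u) (by fun_prop)

lemma measurable_average {f : Case d → ℝ} (hf : Measurable f) {y : ℕ → Ω → Case d}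
    (hy : ∀ i, Measurable (y i)) (n : ℕ) : Measurable fun ω => average n f fun i => y i ω :=
  (Finset.measurable_fun_sum _ fun i _ => hf.comp (hy i)).const_mul _

lemma measurable_average_pattern (g : Pattern d → ℝ) {y : ℕ → Ω → Case d}
    (hy : ∀ i, Measurable (y i)) (n : ℕ) :
    Measurable fun ω => average n (fun c => g c.2) fun i => y i ω :=
  measurable_average ((measurable_pattern_fun g).comp measurable_snd) hy n

lemma measurable_average_mul (g : Pattern d → ℝ) {f : (Fin d → ℝ) → ℝ} (hf : Measurable f)
    {y : ℕ → Ω → Case d} (hy : ∀ i, Measurable (y i)) (n : ℕ) :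
    Measurable fun ω => average n (fun c => g c.2 * f c.1) fun i => y i ω :=
  measurable_average (measurable_case g hf) hy n

lemma measurable_fullMean (T : Finset (Fin d)) (m : Fin d → ℝ) {y : ℕ → Ω → Case d}
    (hy : ∀ i, Measurable (y i)) (n : ℕ) (u : Fin d) :
    Measurable fun ω => fullMean T m n (fun i => y i ω) u :=
  (measurable_average_mul (fullInd T) (f := fun x => x u - m u) (by fun_prop) hy n).div
    (measurable_average_pattern (fullInd T) hy n)

lemma measurable_fullCov (T : Finset (Fin d)) (m : Fin d → ℝ) {y : ℕ → Ω → Case d}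
    (hy : ∀ i, Measurable (y i)) (n : ℕ) (u v : Fin d) :
    Measurable fun ω => fullCov T m n (fun i => y i ω) u v :=
  ((measurable_average_mul (fullInd T) (f := fun x => (x u - m u) * (x v - m v))
    (by fun_prop) hy n).div (measurable_average_pattern (fullInd T) hy n)).sub
    ((measurable_fullMean T m hy n u).mul (measurable_fullMean T m hy n v))

lemma measurable_of_pattern_cases {R : Ω → Pattern d} (hR : Measurable R)
    {F : Pattern d → Ω → ℝ} (hF : ∀ r, Measurable (F r)) : Measurable fun ω => F (R ω) ω := by
  have : Measurable fun q : Ω × Pattern d => F q.2 q.1 :=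
    measurable_from_prod_countable_left fun r => hF r
  exact this.comp (measurable_id.prodMk hR)

lemma measurable_gmmgEstimator {G : SimpleGraph (Fin d)} {X : ℕ → Ω → Fin d → ℝ}
    {R : ℕ → Ω → Pattern d} {θ : ℕ → (s : Finset (Fin d)) → Ω → GaussParam (closedNbhd G s)}
    (hX : ∀ i, Measurable (X i)) (hR : ∀ i, Measurable (R i)) (hθ : IsGaussianFit G X R θ)
    (j : Fin d) (n : ℕ) :
    Measurable fun ω => gmmgEstimator G (fun s => θ n s ω) j n (fun i => X i ω)
      fun i => R i ω := by
  refine (Finset.measurable_fun_sum _ fun i _ => ?_).const_mul _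
  refine measurable_of_pattern_cases (F := fun r ω => imputed G (fun s => θ n s ω) j (X i ω) r)
    (hR i) fun r => ?_
  by_cases hj : r j = false
  · simp only [imputed, hj, dite_true]
    exact measurable_gaussCondMean (hθ.measurable_mean n _) (hθ.measurable_cov n _) _ _
      fun u => (measurable_pi_apply _).comp (hX i)
  · simp only [imputed, hj]
    exact (measurable_pi_apply _).comp (hX i)

lemma measurable_ccEstimator {X : ℕ → Ω → Fin d → ℝ} {R : ℕ → Ω → Pattern d}
    (hX : ∀ i, Measurable (X i)) (hR : ∀ i, Measurable (R i)) (j : Fin d) (n : ℕ) :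
    Measurable fun ω => ccEstimator j n (fun i => X i ω) fun i => R i ω := by
  classical
  refine (Finset.measurable_fun_sum _ fun i _ => ?_).div
    (Finset.measurable_fun_sum _ fun i _ => ?_)
  · refine measurable_of_pattern_cases
      (F := fun r ω => if ∀ v, r v = true then X i ω j else 0) (hR i) fun r => ?_
    split_ifs
    · exact (measurable_pi_apply _).comp (hX i)
    · exact measurable_const
  · exact (measurable_pattern_fun fun r => if ∀ v, r v = true then (1 : ℝ) else 0).comp (hR i)

end Population

section Limits

variable {d : ℕ} {Ω Ω' : Type*} [MeasurableSpace Ω] [MeasurableSpace Ω']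
  {P : Measure Ω} [IsProbabilityMeasure P] {X : Ω → Fin d → ℝ} {R : Ω → Pattern d}
  {P' : Measure Ω'} [IsProbabilityMeasure P'] {X' : ℕ → Ω' → Fin d → ℝ}
  {R' : ℕ → Ω' → Pattern d} {G : SimpleGraph (Fin d)} {j : Fin d}

omit [IsProbabilityMeasure P] [IsProbabilityMeasure P'] in
/-- Strong law for a function of the pattern times a function of the data. -/
lemma RegularMCAR.ae_tendsto_average_mul (h : RegularMCAR P X R)
    (hindep : iIndepFun (fun i ω => (X' i ω, R' i ω)) P')
    (hid : ∀ i, IdentDistrib (fun ω => (X' i ω, R' i ω)) (fun ω => (X ω, R ω)) P' P)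
    (g : Pattern d → ℝ) {f : (Fin d → ℝ) → ℝ} (hf : Measurable f)
    (hint : Integrable (fun ω => f (X ω)) P) :
    ∀ᵐ ω ∂P', Tendsto (fun n => average n (fun c => g c.2 * f c.1)
      fun i => (X' i ω, R' i ω)) atTop (𝓝 ((∫ ω, g (R ω) ∂P) * ∫ ω, f (X ω) ∂P)) := by
  have key := ae_tendsto_average (Y := fun ω => (X ω, R ω)) hindep hid
    (f := fun c : Case d => g c.2 * f c.1) (measurable_case g hf) (h.integrable_mul g hint)
  rw [h.integral_mul g hf] at key
  exact key

omit [IsProbabilityMeasure P'] in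
lemma RegularMCAR.ae_tendsto_average_pattern (h : RegularMCAR P X R)
    (hindep : iIndepFun (fun i ω => (X' i ω, R' i ω)) P')
    (hid : ∀ i, IdentDistrib (fun ω => (X' i ω, R' i ω)) (fun ω => (X ω, R ω)) P' P)
    (g : Pattern d → ℝ) :
    ∀ᵐ ω ∂P', Tendsto (fun n => average n (fun c => g c.2) fun i => (X' i ω, R' i ω)) atTop
      (𝓝 (∫ ω, g (R ω) ∂P)) := by
  simpa using h.ae_tendsto_average_mul hindep hid g (f := fun _ => 1) measurable_const
    (integrable_const _)

omit [IsProbabilityMeasure P'] in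
lemma RegularMCAR.ae_tendsto_fullMean (h : RegularMCAR P X R)
    (hindep : iIndepFun (fun i ω => (X' i ω, R' i ω)) P')
    (hid : ∀ i, IdentDistrib (fun ω => (X' i ω, R' i ω)) (fun ω => (X ω, R ω)) P' P)
    (T : Finset (Fin d)) (u : Fin d) :
    ∀ᵐ ω ∂P', Tendsto (fun n => fullMean T (meanVec P X) n (fun i => (X' i ω, R' i ω)) u)
      atTop (𝓝 0) := by
  filter_upwards [h.ae_tendsto_average_pattern hindep hid (fullInd T),
    h.ae_tendsto_average_mul hindep hid (fullInd T) (f := fun x => x u - meanVec P X u)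
      (by fun_prop) ((h.memLp_center u).integrable (by norm_num))] with ω h1 h2
  rw [h.integral_center, mul_zero] at h2
  have h3 := h2.div h1 (h.obsProb_pos T).ne'
  rw [zero_div] at h3
  exact h3

omit [IsProbabilityMeasure P'] in
lemma RegularMCAR.ae_tendsto_fullCov (h : RegularMCAR P X R)
    (hindep : iIndepFun (fun i ω => (X' i ω, R' i ω)) P')
    (hid : ∀ i, IdentDistrib (fun ω => (X' i ω, R' i ω)) (fun ω => (X ω, R ω)) P' P)
    (T : Finset (Fin d)) :
    ∀ᵐ ω ∂P', ∀ u v, Tendsto (fun n => fullCov T (meanVec P X) n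
      (fun i => (X' i ω, R' i ω)) u v) atTop (𝓝 (covMat P X u v)) := by
  refine ae_all_iff.2 fun u => ae_all_iff.2 fun v => ?_
  filter_upwards [h.ae_tendsto_average_pattern hindep hid (fullInd T),
    h.ae_tendsto_average_mul hindep hid (fullInd T)
      (f := fun x => (x u - meanVec P X u) * (x v - meanVec P X v))
      (by fun_prop) (h.integrable_center_mul u v),
    h.ae_tendsto_fullMean hindep hid T u, h.ae_tendsto_fullMean hindep hid T v]
    with ω h1 h2 h3 h4
  have hq := (h.obsProb_pos T).ne'
  have h5 := (h2.div h1 hq).sub (h3.mul h4)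
  rw [RegularMCAR.integral_center_mul] at h5
  rw [show (∫ ω, fullInd T (R ω) ∂P) = obsProb P R T from rfl] at h5
  rw [mul_div_cancel_left₀ _ hq, mul_zero, sub_zero] at h5
  exact h5

omit [IsProbabilityMeasure P] in
lemma ae_pattern_ne_zero : ∀ᵐ ω ∂P, P (R ⁻¹' {R ω}) ≠ 0 := by
  have h1 : ∀ᵐ ω ∂P, ∀ r, P (R ⁻¹' {r}) = 0 → R ω ≠ r := by
    refine ae_all_iff.2 fun r => ?_
    by_cases hr : P (R ⁻¹' {r}) = 0
    · have : ∀ᵐ ω ∂P, R ω ≠ r := by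
        rw [ae_iff]
        convert hr using 2
        ext ω
        simp
      filter_upwards [this] with ω hω _ using hω
    · exact ae_of_all _ fun _ h => absurd h hr
  filter_upwards [h1] with ω hω h0
  exact hω _ h0 rfl

omit [IsProbabilityMeasure P] [IsProbabilityMeasure P'] in
/-- Almost surely, all cases have patterns of positive probability. -/
lemma ae_forall_pattern_ne_zero
    (hid : ∀ i, IdentDistrib (fun ω => (X' i ω, R' i ω)) (fun ω => (X ω, R ω)) P' P) :
    ∀ᵐ ω ∂P', ∀ i, P (R ⁻¹' {R' i ω}) ≠ 0 := by
  refine ae_all_iff.2 fun i => ?_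
  have hidR : IdentDistrib (R' i) R P' P := (hid i).comp measurable_snd
  filter_upwards [ae_pattern_ne_zero (P := P') (R := R' i)] with ω hω
  rwa [← hidR.measure_mem_eq (measurableSet_singleton _)]

/-- Asymptotic normality of the complete-case estimator. -/
lemma RegularMCAR.hasAsympVar_ccEstimator (h : RegularMCAR P X R)
    (hindep : iIndepFun (fun i ω => (X' i ω, R' i ω)) P')
    (hX' : ∀ i, Measurable (X' i)) (hR' : ∀ i, Measurable (R' i))
    (hid : ∀ i, IdentDistrib (fun ω => (X' i ω, R' i ω)) (fun ω => (X ω, R ω)) P' P)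
    (j : Fin d) :
    HasAsympVar P' (fun n ω => ccEstimator j n (fun i => X' i ω) fun i => R' i ω)
      (meanVec P X j) (Var[ccInfluence P X R j; P]).toNNReal := by
  have hy : ∀ i, Measurable fun ω => (X' i ω, R' i ω) := fun i => (hX' i).prodMk (hR' i)
  have h1 := h.ae_tendsto_average_pattern hindep hid (fullInd Finset.univ)
  have hq := h.obsProb_univ_pos.ne'
  have key := hasAsympVar_of_expansion (K := Unit) (Y := fun ω => (X ω, R ω)) hindep hid
    (f := fun _ c => fullInd Finset.univ c.2 * (c.1 j - meanVec P X j))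
    (fun _ => measurable_case (f := fun x => x j - meanVec P X j) _ (by fun_prop))
    (fun _ => h.memLp_mul _ (h.memLp_center j))
    (fun _ => h.integral_mul_center _ j) (c := fun _ => (obsProb P R Finset.univ)⁻¹)
    (chat := fun n _ ω => (average n (fun c => fullInd Finset.univ c.2)
      fun i => (X' i ω, R' i ω))⁻¹)
    (fun n _ => (measurable_average_pattern (fullInd Finset.univ) hy n).inv.aemeasurable)
    (fun _ => by filter_upwards [h1] with ω hω using hω.inv₀ hq)
    (fun n => (measurable_ccEstimator hX' hR' j n).aemeasurable) (m := meanVec P X j) (by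
      filter_upwards [h1] with ω hω
      filter_upwards [hω.eventually_ne hq] with n hn
      rw [Fintype.sum_unique]
      exact ccEstimator_sub_eq (y := fun i => (X' i ω, R' i ω)) (m := meanVec P X) hn)
  simp only [Finset.univ_unique, Finset.sum_singleton] at key
  exact key

/-- Asymptotic normality of the Gaussian Markov missing graph estimator. -/
lemma RegularMCAR.hasAsympVar_gmmgEstimator (h : RegularMCAR P X R)
    (hindep : iIndepFun (fun i ω => (X' i ω, R' i ω)) P')
    (hX' : ∀ i, Measurable (X' i)) (hR' : ∀ i, Measurable (R' i))
    (hid : ∀ i, IdentDistrib (fun ω => (X' i ω, R' i ω)) (fun ω => (X ω, R ω)) P' P)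
    {θ : ℕ → (s : Finset (Fin d)) → Ω' → GaussParam (closedNbhd G s)}
    (hθ : IsGaussianFit G X' R' θ) (j : Fin d) :
    HasAsympVar P' (fun n ω => gmmgEstimator G (fun s => θ n s ω) j n (fun i => X' i ω)
      fun i => R' i ω) (meanVec P X j) (Var[gmmgInfluence P X R G j; P]).toNNReal := by
  classical
  have hy : ∀ i, Measurable fun ω => (X' i ω, R' i ω) := fun i => (hX' i).prodMk (hR' i)
  have hfull := fun s => h.ae_tendsto_average_pattern hindep hid (fullInd (closedNbhd G s))
  have hcomp := fun s => h.ae_tendsto_average_pattern hindep hid (compInd G j s)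
  have hcov := fun s => h.ae_tendsto_fullCov hindep hid (closedNbhd G s)
  have hQ : (covMat P X).PosDef := h.posDef
  let y : Ω' → ℕ → Case d := fun ω i => (X' i ω, R' i ω)
  refine hasAsympVar_of_expansion (K := TermIndex (compSet P R G j)) (Y := fun ω => (X ω, R ω))
    hindep hid (f := term G j (meanVec P X)) measurable_term h.memLp_term h.integral_term
    (c := limitCoef P X R G j)
    (chat := fun n k ω => termCoef j
      (fun s => regCoef (fullCov (closedNbhd G s) (meanVec P X) n (y ω)) (nbhd G s) j)
      (fun s => average n (fun c => compInd G j s c.2) (y ω) /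
        average n (fun c => fullInd (closedNbhd G s) c.2) (y ω)) k) ?_ ?_
    (fun n => (measurable_gmmgEstimator hX' hR' hθ j n).aemeasurable) ?_
  · intro n k
    refine Measurable.aemeasurable ?_
    have hreg : ∀ s u, Measurable fun ω => regCoef
        (fullCov (closedNbhd G s) (meanVec P X) n (y ω)) (nbhd G s) j u := fun s u =>
      measurable_regCoef (measurable_fullCov _ _ hy n) _ _ _
    match k with
    | none => exact measurable_const
    | some (s, u, true) => exact hreg s u
    | some (s, u, false) =>
      exact ((measurable_average_pattern (compInd G j s) hy n).div
        (measurable_average_pattern (fullInd (closedNbhd G s)) hy n)).mul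
        ((hreg s u).const_sub (if u = j then 1 else 0))
  · intro k
    match k with
    | none => exact ae_of_all _ fun _ => tendsto_const_nhds
    | some (s, u, true) =>
      filter_upwards [hcov s.1] with ω hω
      exact tendsto_regCoef hQ hω _ _ _
    | some (s, u, false) =>
      filter_upwards [hcov s.1, hfull s.1, hcomp s.1] with ω h1 h2 h3
      exact (h3.div h2 (h.obsProb_pos _).ne').mul
        ((tendsto_regCoef hQ h1 _ _ _).const_sub _)
  · have hfull' := ae_all_iff.2 hfull
    have hcov' := ae_all_iff.2 hcov
    filter_upwards [hfull', hcov', ae_forall_pattern_ne_zero hid]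
      with ω h1 h2 h3
    have hne : ∀ᶠ n in atTop, ∀ s ∈ compSet P R G j,
        average n (fun c => fullInd (closedNbhd G s) c.2) (y ω) ≠ 0 :=
      (Filter.eventually_all_finset _).2 fun s _ => (h1 s).eventually_ne (h.obsProb_pos _).ne'
    have hdet : ∀ᶠ n in atTop, ∀ s ∈ compSet P R G j,
        (fullCov (closedNbhd G s) (meanVec P X) n (y ω)).det ≠ 0 := by
      refine (Filter.eventually_all_finset _).2 fun s _ => ?_
      have h4 : Tendsto (fun n => fullCov (closedNbhd G s) (meanVec P X) n (y ω)) atTop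
          (𝓝 (covMat P X)) := tendsto_pi_nhds.2 fun u => tendsto_pi_nhds.2 fun v => h2 s u v
      have h5 : Continuous fun M : Matrix (Fin d) (Fin d) ℝ => M.det := by fun_prop
      exact ((h5.tendsto _).comp h4).eventually_ne hQ.det_pos.ne'
    filter_upwards [hne, hdet, eventually_gt_atTop 0] with n hn1 hn2 hn3
    refine gmmgEstimator_sub_eq (y := y ω)
      (M := fun s => fullCov (closedNbhd G s) (meanVec P X) n (y ω)) hn3 ?_ ?_
    · intro s hs
      have hI : (fullCases G s n fun i => R' i ω).Nonempty := by
        by_contra hI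
        rw [Finset.not_nonempty_iff_eq_empty] at hI
        refine hn1 s hs ?_
        rw [average_fullInd]
        change (n : ℝ)⁻¹ * ((fullCases G s n fun i => R' i ω).card : ℝ) = 0
        simp [hI]
      have hcovS := sampleCov_fullCases (y := y ω) hI (meanVec P X)
      have hconn : IsConnectedPattern G s := by
        obtain ⟨r, hr, rfl⟩ := Finset.mem_image.1 hs
        exact isConnectedPattern_missComp (Finset.mem_filter.1 hr).2.1
      have hpd : (sampleCov (fullCases G s n fun i => R' i ω) fun i => X' i ω).PosDef := by
        rw [(posSemidef_sampleCov _ _).posDef_iff_det_ne_zero]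
        change (sampleCov (fullCases G s n fun i => (y ω i).2) fun i => (y ω i).1).det ≠ 0
        rw [hcovS]
        exact hn2 s hs
      obtain ⟨h6, h7⟩ := hθ.eq_sample hconn hI hpd
      refine ⟨?_, ?_⟩
      · rw [h6]
        ext u
        exact sampleMean_fullCases (y := y ω) hI (meanVec P X) u
      · rw [h7]
        exact congrArg (fun M : Matrix (Fin d) (Fin d) ℝ => M.submatrix _ _) hcovS
    · intro i hi
      exact Finset.mem_image_of_mem _ (Finset.mem_filter.2 ⟨Finset.mem_univ _, hi, h3 i⟩)

end Limits

/-! ### Comparison of the asymptotic variances -/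

section Variance

variable {d : ℕ} {Ω : Type*} [MeasurableSpace Ω] {P : Measure Ω}
  {X : Ω → Fin d → ℝ} {R : Ω → Pattern d} {G : SimpleGraph (Fin d)} {j : Fin d}

/-- The residual of the linear regression of the `j`-th variable on the variables in `N`. -/
noncomputable def residual (P : Measure Ω) (X : Ω → Fin d → ℝ) (N : Finset (Fin d)) (j : Fin d)
    (x : Fin d → ℝ) : ℝ :=
  (x j - meanVec P X j) - ∑ u, regCoef (covMat P X) N j u * (x u - meanVec P X u)

/-- The residual variance of the linear regression of the `j`-th variable on those in `N`. -/
noncomputable def residualVar (P : Measure Ω) (X : Ω → Fin d → ℝ) (N : Finset (Fin d))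
    (j : Fin d) : ℝ :=
  ∫ ω, residual P X N j (X ω) ^ 2 ∂P

lemma measurable_residual (N : Finset (Fin d)) : Measurable (residual P X N j) := by
  unfold residual; fun_prop

lemma mem_compSet {s : Finset (Fin d)} : s ∈ compSet P R G j ↔
    ∃ r : Pattern d, r j = false ∧ P (R ⁻¹' {r}) ≠ 0 ∧ missComp G r j = s := by
  simp [compSet, and_assoc]

lemma fullInd_eq_zero_of_mem_compSet {s : Finset (Fin d)} (hs : s ∈ compSet P R G j)
    {p : Pattern d} (hp : p j = false) : fullInd (closedNbhd G s) p = 0 := by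
  obtain ⟨r, hr, -, rfl⟩ := mem_compSet.1 hs
  refine if_neg fun h => ?_
  simpa [hp] using h j (mem_closedNbhd_missComp G hr)

lemma sum_compInd_le (A : Finset (Finset (Fin d))) (p : Pattern d) :
    ∑ s ∈ A, compInd G j s p ≤ 1 := by
  classical
  by_cases hj : p j = false
  · simp only [compInd, hj, true_and, Finset.sum_ite_eq]
    split_ifs <;> norm_num
  · simp [compInd, hj]

lemma fullInd_sq (T : Finset (Fin d)) (p : Pattern d) : fullInd T p ^ 2 = fullInd T p := by
  unfold fullInd; split_ifs <;> norm_num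

lemma gmmgInfluence_eq (ω : Ω) : gmmgInfluence P X R G j ω =
    fullInd {j} (R ω) * (X ω j - meanVec P X j) + ∑ s ∈ compSet P R G j,
      (compInd G j s (R ω) * ((X ω j - meanVec P X j) - residual P X (nbhd G s) j (X ω)) +
        compProb P R G j s / obsProb P R (closedNbhd G s) *
          (fullInd (closedNbhd G s) (R ω) * residual P X (nbhd G s) j (X ω))) := by
  rw [gmmgInfluence, sum_termIndex, ← Finset.sum_coe_sort (compSet P R G j)]
  congr 1
  · simp [limitCoef, termCoef, term]
  · refine Finset.sum_congr rfl fun s _ => ?_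
    have h1 : X ω j - meanVec P X j =
        ∑ u, (if u = j then 1 else 0) * (X ω u - meanVec P X u) := by simp
    rw [Finset.sum_add_distrib]
    simp only [limitCoef, termCoef, term]
    congr 1
    · rw [residual, sub_sub_cancel, Finset.mul_sum]
      exact Finset.sum_congr rfl fun u _ => by ring
    · rw [residual, h1, ← Finset.sum_sub_distrib, Finset.mul_sum, Finset.mul_sum]
      exact Finset.sum_congr rfl fun u _ => by ring

/-- A quadratic bound for the square of the influence function, in which every term is a function
of the pattern times a function of the data. When `j` is missing, only the term of its own component
is present and there is equality. When `j` is observed, the Cauchy–Schwarz inequality bounds the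
square of the sum over the components, whose mixed products need not have a usable sign. -/
lemma gmmgInfluence_sq_le {ω : Ω} (hω : P (R ⁻¹' {R ω}) ≠ 0)
    (hπ : ∀ s ∈ compSet P R G j, 0 ≤ compProb P R G j s) :
    gmmgInfluence P X R G j ω ^ 2 ≤ (X ω j - meanVec P X j) ^ 2 +
      ∑ s ∈ compSet P R G j,
        (compInd G j s (R ω) * (residual P X (nbhd G s) j (X ω) ^ 2 -
            2 * (residual P X (nbhd G s) j (X ω) * (X ω j - meanVec P X j))) +
          fullInd (closedNbhd G s) (R ω) *
            (2 * (compProb P R G j s / obsProb P R (closedNbhd G s)) *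
                (residual P X (nbhd G s) j (X ω) * (X ω j - meanVec P X j)) +
              (∑ t ∈ compSet P R G j, compProb P R G j t) *
                (compProb P R G j s / obsProb P R (closedNbhd G s) ^ 2) *
                residual P X (nbhd G s) j (X ω) ^ 2)) := by
  classical
  rw [gmmgInfluence_eq]
  set z := X ω j - meanVec P X j
  set e := fun s => residual P X (nbhd G s) j (X ω)
  by_cases hj : R ω j = false
  · have hmem : missComp G (R ω) j ∈ compSet P R G j := mem_compSet.2 ⟨R ω, hj, hω, rfl⟩
    have hw : ∀ s ∈ compSet P R G j, fullInd (closedNbhd G s) (R ω) = 0 := fun s hs =>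
      fullInd_eq_zero_of_mem_compSet hs hj
    have hκ : ∀ s, s ≠ missComp G (R ω) j → compInd G j s (R ω) = 0 := fun s hs => by
      simp [compInd, hs.symm]
    have hκ1 : compInd G j (missComp G (R ω) j) (R ω) = 1 := by simp [compInd, hj]
    rw [Finset.sum_eq_single_of_mem _ hmem fun s hs hne => by rw [hw s hs, hκ s hne]; ring,
      Finset.sum_eq_single_of_mem _ hmem fun s hs hne => by rw [hw s hs, hκ s hne]; ring,
      hw _ hmem, hκ1]
    have : fullInd {j} (R ω) = 0 := by simp [fullInd, hj]
    rw [this]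
    exact le_of_eq (by ring)
  · have hκ : ∀ s, compInd G j s (R ω) = 0 := fun s => by simp [compInd, hj]
    have h1 : fullInd {j} (R ω) = 1 := by simpa [fullInd] using hj
    simp only [hκ, h1, zero_mul, zero_add, one_mul]
    -- Cauchy–Schwarz with the weights `compProb`
    have hCS := Finset.sum_sq_le_sum_mul_sum_of_sq_le_mul (compSet P R G j)
      (r := fun s => compProb P R G j s / obsProb P R (closedNbhd G s) *
        (fullInd (closedNbhd G s) (R ω) * e s))
      (f := fun s => compProb P R G j s)
      (g := fun s => compProb P R G j s / obsProb P R (closedNbhd G s) ^ 2 *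
        (fullInd (closedNbhd G s) (R ω) * e s ^ 2)) hπ
      (fun s hs => mul_nonneg (div_nonneg (hπ s hs) (sq_nonneg _))
        (mul_nonneg (fullInd_nonneg _ _) (sq_nonneg _)))
      (fun s _ => by
        rw [mul_pow, mul_pow, fullInd_sq, div_pow]
        exact le_of_eq (by ring))
    have h2 : ∑ s ∈ compSet P R G j, fullInd (closedNbhd G s) (R ω) *
        (2 * (compProb P R G j s / obsProb P R (closedNbhd G s)) * (e s * z) +
          (∑ t ∈ compSet P R G j, compProb P R G j t) *
            (compProb P R G j s / obsProb P R (closedNbhd G s) ^ 2) * e s ^ 2) =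
        2 * z * (∑ s ∈ compSet P R G j, compProb P R G j s / obsProb P R (closedNbhd G s) *
          (fullInd (closedNbhd G s) (R ω) * e s)) +
        (∑ t ∈ compSet P R G j, compProb P R G j t) *
          ∑ s ∈ compSet P R G j, compProb P R G j s / obsProb P R (closedNbhd G s) ^ 2 *
            (fullInd (closedNbhd G s) (R ω) * e s ^ 2) := by
      rw [Finset.mul_sum (compSet P R G j) _ (2 * z),
        Finset.mul_sum (compSet P R G j) (fun s => compProb P R G j s / _ * _),
        ← Finset.sum_add_distrib]
      exact Finset.sum_congr rfl fun s _ => by ring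
    rw [h2, add_sq]
    linarith

namespace RegularMCAR

variable [IsProbabilityMeasure P] (h : RegularMCAR P X R)

include h

lemma memLp_residual (N : Finset (Fin d)) : MemLp (fun ω => residual P X N j (X ω)) 2 P :=
  (h.memLp_center j).sub (memLp_finsetSum _ fun u _ => (h.memLp_center u).const_mul _)

lemma integrable_residual_mul (N : Finset (Fin d)) (v : Fin d) :
    Integrable (fun ω => residual P X N j (X ω) * (X ω v - meanVec P X v)) P :=
  (h.memLp_residual N).integrable_mul (h.memLp_center v)

lemma integrable_residual_sq (N : Finset (Fin d)) :
    Integrable (fun ω => residual P X N j (X ω) ^ 2) P :=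
  (h.memLp_residual N).integrable_sq

lemma integral_residual_mul (N : Finset (Fin d)) (v : Fin d) :
    ∫ ω, residual P X N j (X ω) * (X ω v - meanVec P X v) ∂P =
      covMat P X j v - ∑ u, regCoef (covMat P X) N j u * covMat P X u v := by
  have h1 : ∀ ω, residual P X N j (X ω) * (X ω v - meanVec P X v) =
      (X ω j - meanVec P X j) * (X ω v - meanVec P X v) -
        ∑ u, regCoef (covMat P X) N j u *
          ((X ω u - meanVec P X u) * (X ω v - meanVec P X v)) := by
    intro ω
    rw [residual, sub_mul, Finset.sum_mul]
    congr 1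
    exact Finset.sum_congr rfl fun u _ => by ring
  simp_rw [h1]
  rw [integral_sub (h.integrable_center_mul j v)
      (integrable_finsetSum _ fun u _ => (h.integrable_center_mul u v).const_mul _),
    integral_finsetSum _ fun u _ => (h.integrable_center_mul u v).const_mul _]
  simp only [integral_const_mul, integral_center_mul]

/-- The residual is uncorrelated with the regressors. -/
lemma integral_residual_mul_eq_zero {N : Finset (Fin d)} {v : Fin d} (hv : v ∈ N) :
    ∫ ω, residual P X N j (X ω) * (X ω v - meanVec P X v) ∂P = 0 := by
  have hQ : (covMat P X).PosDef := h.posDef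
  rw [h.integral_residual_mul, sum_regCoef_mul hQ hv, sub_self]

lemma residualVar_eq (N : Finset (Fin d)) : residualVar P X N j =
    ∫ ω, residual P X N j (X ω) * (X ω j - meanVec P X j) ∂P := by
  have h1 : ∀ ω, residual P X N j (X ω) ^ 2 =
      residual P X N j (X ω) * (X ω j - meanVec P X j) -
        ∑ u, regCoef (covMat P X) N j u *
          (residual P X N j (X ω) * (X ω u - meanVec P X u)) := by
    intro ω
    rw [sq]
    nth_rw 2 [residual]
    rw [mul_sub, Finset.mul_sum]
    congr 1
    exact Finset.sum_congr rfl fun u _ => by ring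
  rw [residualVar]
  simp_rw [h1]
  rw [integral_sub (h.integrable_residual_mul N j)
      (integrable_finsetSum _ fun u _ => (h.integrable_residual_mul N u).const_mul _),
    integral_finsetSum _ fun u _ => (h.integrable_residual_mul N u).const_mul _]
  rw [Finset.sum_eq_zero, sub_zero]
  intro u _
  rw [integral_const_mul]
  by_cases hu : u ∈ N
  · rw [h.integral_residual_mul_eq_zero hu, mul_zero]
  · rw [regCoef_of_notMem hu, zero_mul]

/-- Decomposition of the variance into the residual and the explained variance. -/
lemma covMat_self_eq (N : Finset (Fin d)) : covMat P X j j = residualVar P X N j +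
    regCoef (covMat P X) N j ⬝ᵥ (covMat P X *ᵥ regCoef (covMat P X) N j) := by
  rw [h.residualVar_eq, h.integral_residual_mul]
  have hsymm : ∀ u v, covMat P X u v = covMat P X v u := fun u v => by
    simp [covMat, covariance_comm]
  have h1 : ∀ u, regCoef (covMat P X) N j u * covMat P X u j =
      regCoef (covMat P X) N j u * ∑ v, covMat P X u v * regCoef (covMat P X) N j v := by
    intro u
    by_cases hu : u ∈ N
    · rw [hsymm u j, ← sum_regCoef_mul (M := covMat P X) h.posDef hu]
      congr 1
      exact Finset.sum_congr rfl fun v _ => by rw [hsymm u v, mul_comm]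
    · rw [regCoef_of_notMem hu, zero_mul, zero_mul]
  simp only [dotProduct, Matrix.mulVec]
  rw [Finset.sum_congr rfl fun u _ => h1 u, sub_add_cancel]

lemma residualVar_le (N : Finset (Fin d)) : residualVar P X N j ≤ covMat P X j j := by
  have hQ : (covMat P X).PosDef := h.posDef
  have := hQ.posSemidef.dotProduct_mulVec_nonneg (regCoef (covMat P X) N j)
  rw [h.covMat_self_eq N]
  simpa using this

lemma residualVar_lt {N : Finset (Fin d)} {u : Fin d} (hu : u ∈ N) (hju : covMat P X j u ≠ 0) :
    residualVar P X N j < covMat P X j j := by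
  have hQ : (covMat P X).PosDef := h.posDef
  have hb : regCoef (covMat P X) N j ≠ 0 := by
    intro hb
    refine hju ?_
    rw [← sum_regCoef_mul hQ hu, hb]
    simp
  have := hQ.dotProduct_mulVec_pos hb
  rw [h.covMat_self_eq N]
  simpa using this

omit h [IsProbabilityMeasure P] in
lemma residualVar_nonneg (N : Finset (Fin d)) : 0 ≤ residualVar P X N j :=
  integral_nonneg fun _ => sq_nonneg _

omit h [IsProbabilityMeasure P] in
lemma compProb_nonneg (s : Finset (Fin d)) : 0 ≤ compProb P R G j s :=
  integral_nonneg fun _ => compInd_nonneg _ _ _ _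

/-- Bound for the asymptotic variance of the Gaussian Markov missing graph estimator, obtained by
integrating `gmmgInfluence_sq_le`; the mixed products of a residual and variable `j` integrate to the
residual variance. -/
lemma variance_gmmgInfluence_le : Var[gmmgInfluence P X R G j; P] ≤ covMat P X j j +
    ∑ s ∈ compSet P R G j, (compProb P R G j s * residualVar P X (nbhd G s) j +
      (∑ t ∈ compSet P R G j, compProb P R G j t) * (compProb P R G j s *
        residualVar P X (nbhd G s) j / obsProb P R (closedNbhd G s))) := by
  have hL2 : MemLp (gmmgInfluence P X R G j) 2 P :=
    memLp_finsetSum _ fun k _ => (h.memLp_term k).const_mul _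
  have hI1 : ∀ s, Integrable (fun ω => residual P X (nbhd G s) j (X ω) ^ 2 -
      2 * (residual P X (nbhd G s) j (X ω) * (X ω j - meanVec P X j))) P := fun s =>
    (h.integrable_residual_sq _).sub ((h.integrable_residual_mul _ j).const_mul 2)
  have hI2 : ∀ s, Integrable (fun ω =>
      2 * (compProb P R G j s / obsProb P R (closedNbhd G s)) *
        (residual P X (nbhd G s) j (X ω) * (X ω j - meanVec P X j)) +
      (∑ t ∈ compSet P R G j, compProb P R G j t) *
        (compProb P R G j s / obsProb P R (closedNbhd G s) ^ 2) *
        residual P X (nbhd G s) j (X ω) ^ 2) P := fun s =>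
    ((h.integrable_residual_mul _ j).const_mul _).add ((h.integrable_residual_sq _).const_mul _)
  have hz : Integrable (fun ω => (X ω j - meanVec P X j) ^ 2) P := (h.memLp_center j).integrable_sq
  have hm : ∀ s, Measurable (residual P X (nbhd G s) j) := fun s => measurable_residual _
  refine (variance_le_expectation_sq hL2.1).trans ?_
  have hA := fun s => h.integrable_mul (compInd G j s) (hI1 s)
  have hB := fun s => h.integrable_mul (fullInd (closedNbhd G s)) (hI2 s)
  have hAB := fun s => (hA s).fun_add (hB s)
  have hS := integrable_finsetSum (compSet P R G j) fun s _ => hAB s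
  have hmono := integral_mono_ae hL2.integrable_sq (hz.fun_add hS) (by
    filter_upwards [ae_pattern_ne_zero (P := P) (R := R)] with ω hω
    exact gmmgInfluence_sq_le hω fun s _ => compProb_nonneg s)
  refine hmono.trans (le_of_eq ?_)
  have h1 : ∫ ω, (X ω j - meanVec P X j) ^ 2 ∂P = covMat P X j j := by
    simp_rw [sq]
    exact integral_center_mul j j
  rw [integral_add hz hS, integral_finsetSum _ fun s _ => hAB s, h1]
  congr 1
  refine Finset.sum_congr rfl fun s _ => ?_
  rw [integral_add (hA s) (hB s)]
  have h2 := h.integral_mul (compInd G j s) (f := fun x => residual P X (nbhd G s) j x ^ 2 -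
      2 * (residual P X (nbhd G s) j x * (x j - meanVec P X j))) (by fun_prop)
  have h3 := h.integral_mul (fullInd (closedNbhd G s)) (f := fun x =>
      2 * (compProb P R G j s / obsProb P R (closedNbhd G s)) *
        (residual P X (nbhd G s) j x * (x j - meanVec P X j)) +
      (∑ t ∈ compSet P R G j, compProb P R G j t) *
        (compProb P R G j s / obsProb P R (closedNbhd G s) ^ 2) *
        residual P X (nbhd G s) j x ^ 2) (by fun_prop)
  rw [h2, h3, integral_sub (h.integrable_residual_sq _)
      ((h.integrable_residual_mul _ j).const_mul 2),
    integral_add ((h.integrable_residual_mul _ j).const_mul _)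
      ((h.integrable_residual_sq _).const_mul _)]
  simp only [integral_const_mul]
  rw [← h.residualVar_eq]
  change compProb P R G j s * (residualVar P X (nbhd G s) j -
    2 * residualVar P X (nbhd G s) j) + obsProb P R (closedNbhd G s) * (_ * _ + _ * _ *
      residualVar P X (nbhd G s) j) = _
  have hq := (h.obsProb_pos (closedNbhd G s)).ne'
  field_simp
  ring

/-- The asymptotic variance of the complete-case estimator. -/
lemma variance_ccInfluence : Var[ccInfluence P X R j; P] =
    covMat P X j j / obsProb P R Finset.univ := by
  have hL2 : MemLp (ccInfluence P X R j) 2 P := (h.memLp_mul _ (h.memLp_center j)).const_mul _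
  have h0 : ∫ ω, ccInfluence P X R j ω ∂P = 0 := by
    simp only [ccInfluence]
    rw [integral_const_mul, h.integral_mul_center, mul_zero]
  rw [variance_of_integral_eq_zero hL2.1.aemeasurable h0]
  have h1 : ∀ ω, ccInfluence P X R j ω ^ 2 = (obsProb P R Finset.univ)⁻¹ ^ 2 *
      (fullInd Finset.univ (R ω) * ((X ω j - meanVec P X j) * (X ω j - meanVec P X j))) := by
    intro ω
    rw [ccInfluence, mul_pow, mul_pow, fullInd_sq, sq (X ω j - meanVec P X j)]
  simp_rw [h1]
  rw [integral_const_mul, h.integral_mul (fullInd Finset.univ)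
    (f := fun x => (x j - meanVec P X j) * (x j - meanVec P X j)) (by fun_prop),
    integral_center_mul]
  change _ * (obsProb P R Finset.univ * _) = _
  have hp := h.obsProb_univ_pos.ne'
  field_simp

/-- The probabilities of a complete case, of missing `j`, and of an incomplete case with `j` observed
and pattern in `S` add up to at most one. -/
lemma sum_compProb_add_le {S : Set (Pattern d)}
    (hS : ∀ r ∈ S, r j = true ∧ ∃ u, r u = false) :
    ∑ s ∈ compSet P R G j, compProb P R G j s + obsProb P R Finset.univ +
      P.real (R ⁻¹' S) ≤ 1 := by
  have hm : MeasurableSet (R ⁻¹' S) := h.measurable_pattern S.toFinite.measurableSet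
  have hi : Integrable (fun ω => ∑ s ∈ compSet P R G j, compInd G j s (R ω)) P :=
    integrable_finsetSum _ fun s _ => h.integrable_pattern _
  have hi2 := h.integrable_pattern (fullInd Finset.univ)
  have hi3 : Integrable ((R ⁻¹' S).indicator (1 : Ω → ℝ)) P :=
    (integrable_const (1 : ℝ)).indicator hm
  have h1 : ∑ s ∈ compSet P R G j, compProb P R G j s + obsProb P R Finset.univ +
      P.real (R ⁻¹' S) = ∫ ω, ((∑ s ∈ compSet P R G j, compInd G j s (R ω)) +
        fullInd Finset.univ (R ω) + (R ⁻¹' S).indicator (1 : Ω → ℝ) ω) ∂P := by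
    rw [integral_add (hi.fun_add hi2) hi3, integral_add hi hi2,
      integral_finsetSum _ fun s _ => h.integrable_pattern _, integral_indicator_one hm]
    rfl
  rw [h1]
  have h2 : ∫ _, (1 : ℝ) ∂P = 1 := by simp
  rw [← h2]
  refine integral_mono ((hi.fun_add hi2).fun_add hi3) (integrable_const _) fun ω => ?_
  change (∑ s ∈ compSet P R G j, compInd G j s (R ω)) +
    fullInd Finset.univ (R ω) + (R ⁻¹' S).indicator (1 : Ω → ℝ) ω ≤ 1
  have hsum := sum_compInd_le (compSet P R G j) (G := G) (j := j) (R ω)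
  by_cases hj : R ω j = false
  · have h3 : fullInd Finset.univ (R ω) = 0 := if_neg fun hall => by
      simpa [hj] using hall j (Finset.mem_univ j)
    have h4 : ω ∉ R ⁻¹' S := fun hω => by simpa [hj] using (hS _ hω).1
    rw [h3, Set.indicator_of_notMem h4]
    linarith
  · rw [Finset.sum_eq_zero fun s _ => by simp [compInd, hj]]
    by_cases hω : ω ∈ R ⁻¹' S
    · have h3 : fullInd Finset.univ (R ω) = 0 := if_neg fun hall => by
        obtain ⟨u, hu⟩ := (hS _ hω).2
        simpa [hu] using hall u (Finset.mem_univ u)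
      rw [h3, Set.indicator_of_mem hω]
      simp
    · rw [Set.indicator_of_notMem hω]
      linarith [fullInd_le_one Finset.univ (R ω)]

lemma sum_compProb_add_le_one :
    ∑ s ∈ compSet P R G j, compProb P R G j s + obsProb P R Finset.univ ≤ 1 := by
  simpa using h.sum_compProb_add_le (G := G) (j := j) (S := ∅) (by simp)

lemma compProb_pos {r : Pattern d} (hr : r j = false) (hP : P (R ⁻¹' {r}) ≠ 0) :
    0 < compProb P R G j (missComp G r j) := by
  have hm : MeasurableSet (R ⁻¹' {r}) := h.measurable_pattern (measurableSet_singleton r)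
  have h1 : P.real (R ⁻¹' {r}) ≤ compProb P R G j (missComp G r j) := by
    rw [← integral_indicator_one hm]
    refine integral_mono ((integrable_const (1 : ℝ)).indicator hm) (h.integrable_pattern _)
      fun ω => ?_
    by_cases hω : R ω = r
    · rw [Set.indicator_of_mem (by exact hω)]
      simp [compInd, hω, hr]
    · rw [Set.indicator_of_notMem (by exact hω)]
      exact compInd_nonneg _ _ _ _
  exact (ENNReal.toReal_pos hP (measure_ne_top _ _)).trans_le h1

omit [IsProbabilityMeasure P] in
lemma covMat_self_pos : 0 < covMat P X j j := by
  have hQ : (covMat P X).PosDef := h.posDef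
  exact hQ.diag_pos

/-- A weaker bound, from the fact that the cases that enter a fit are at least as frequent as the
complete cases. -/
lemma variance_gmmgInfluence_le_of_complete : Var[gmmgInfluence P X R G j; P] ≤ covMat P X j j +
    (∑ s ∈ compSet P R G j, compProb P R G j s * residualVar P X (nbhd G s) j) *
      (1 + (∑ t ∈ compSet P R G j, compProb P R G j t) / obsProb P R Finset.univ) := by
  refine h.variance_gmmgInfluence_le.trans ?_
  rw [Finset.sum_mul]
  gcongr with s hs
  have h1 : compProb P R G j s * residualVar P X (nbhd G s) j / obsProb P R (closedNbhd G s) ≤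
      compProb P R G j s * residualVar P X (nbhd G s) j / obsProb P R Finset.univ :=
    div_le_div_of_nonneg_left (mul_nonneg (compProb_nonneg s) (residualVar_nonneg _))
      h.obsProb_univ_pos (h.obsProb_univ_le _)
  have h2 : 0 ≤ ∑ t ∈ compSet P R G j, compProb P R G j t :=
    Finset.sum_nonneg fun t _ => compProb_nonneg t
  calc _ ≤ compProb P R G j s * residualVar P X (nbhd G s) j +
        (∑ t ∈ compSet P R G j, compProb P R G j t) *
          (compProb P R G j s * residualVar P X (nbhd G s) j / obsProb P R Finset.univ) := by
        gcongr
    _ = _ := by ring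

lemma sum_compProb_mul_residualVar_le :
    ∑ s ∈ compSet P R G j, compProb P R G j s * residualVar P X (nbhd G s) j ≤
      (∑ s ∈ compSet P R G j, compProb P R G j s) * covMat P X j j := by
  rw [Finset.sum_mul]
  exact Finset.sum_le_sum fun s _ =>
    mul_le_mul_of_nonneg_left (h.residualVar_le _) (compProb_nonneg s)

omit h [IsProbabilityMeasure P] in
/-- The elementary inequality behind the comparison: `c` is the variance of the variable, `a` the
expected residual variance of the imputed values, `π` the probability of a missing value, and `p`
that of a complete case. -/
lemma add_mul_le_div {c a π p : ℝ} (hc : 0 < c) (hp : 0 < p) (hπ : 0 ≤ π) (ha : a ≤ π * c)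
    (hpπ : π + p ≤ 1) :
    c + a * (1 + π / p) ≤ c / p ∧ (a < π * c ∨ π + p < 1 → c + a * (1 + π / p) < c / p) := by
  have h1 : 0 < 1 + π / p := by positivity
  have h2 : c + π * c * (1 + π / p) = c / p - c / p * ((1 - π - p) * (1 + π)) := by
    field_simp
    ring
  have h3 : 0 < c / p := by positivity
  have h4 : a * (1 + π / p) ≤ π * c * (1 + π / p) := mul_le_mul_of_nonneg_right ha h1.le
  have h5 : 0 ≤ c / p * ((1 - π - p) * (1 + π)) :=
    mul_nonneg h3.le (mul_nonneg (by linarith) (by linarith))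
  refine ⟨by linarith, ?_⟩
  rintro (h6 | h6)
  · have h7 : a * (1 + π / p) < π * c * (1 + π / p) := mul_lt_mul_of_pos_right h6 h1
    linarith
  · have h7 : 0 < c / p * ((1 - π - p) * (1 + π)) :=
      mul_pos h3 (mul_pos (by linarith) (by linarith))
    linarith

/-- The Gaussian Markov missing graph estimator is at least as efficient as the complete-case
estimator. -/
lemma variance_gmmgInfluence_le_cc :
    Var[gmmgInfluence P X R G j; P] ≤ Var[ccInfluence P X R j; P] := by
  rw [h.variance_ccInfluence]
  exact h.variance_gmmgInfluence_le_of_complete.trans (add_mul_le_div h.covMat_self_pos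
    h.obsProb_univ_pos (Finset.sum_nonneg fun t _ => compProb_nonneg t)
    h.sum_compProb_mul_residualVar_le h.sum_compProb_add_le_one).1

/-- It is more efficient when, with positive probability, an incomplete case has `j` observed, or
has `j` missing and a neighbour of the component of `j` correlated with `j`. -/
lemma variance_gmmgInfluence_lt_cc {r : Pattern d} (hP : P (R ⁻¹' {r}) ≠ 0)
    (hinc : ∃ u, r u = false)
    (hr : r j = false → ∃ u ∈ nbhd G (missComp G r j), covMat P X j u ≠ 0) :
    Var[gmmgInfluence P X R G j; P] < Var[ccInfluence P X R j; P] := by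
  rw [h.variance_ccInfluence]
  refine h.variance_gmmgInfluence_le_of_complete.trans_lt ((add_mul_le_div h.covMat_self_pos
    h.obsProb_univ_pos (Finset.sum_nonneg fun t _ => compProb_nonneg t)
    h.sum_compProb_mul_residualVar_le h.sum_compProb_add_le_one).2 ?_)
  by_cases hj : r j = false
  · left
    obtain ⟨u, hu, hju⟩ := hr hj
    rw [Finset.sum_mul]
    refine Finset.sum_lt_sum (fun s _ =>
      mul_le_mul_of_nonneg_left (h.residualVar_le _) (compProb_nonneg s))
      ⟨missComp G r j, mem_compSet.2 ⟨r, hj, hP, rfl⟩, ?_⟩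
    exact mul_lt_mul_of_pos_left (h.residualVar_lt hu hju) (h.compProb_pos hj hP)
  · right
    have h1 := h.sum_compProb_add_le (G := G) (j := j) (S := {r}) (by
      rintro _ rfl
      exact ⟨by simpa using hj, hinc⟩)
    have h2 : 0 < P.real (R ⁻¹' {r}) := ENNReal.toReal_pos hP (measure_ne_top _ _)
    linarith

end RegularMCAR

end Variance

section Faithful

variable {d : ℕ} {G : SimpleGraph (Fin d)}

/-- Conditioning on the trivial σ-algebra does nothing. -/
lemma condIndepFun_of_eq_bot {Ω β β' : Type*} {mΩ : MeasurableSpace Ω} [StandardBorelSpace Ω]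
    [MeasurableSpace β] [MeasurableSpace β'] {μ : Measure Ω} [IsProbabilityMeasure μ]
    {f : Ω → β} {g : Ω → β'} (hf : Measurable f) (hg : Measurable g) (h : IndepFun f g μ)
    {m' : MeasurableSpace Ω} (hm' : m' ≤ mΩ) (hbot : m' = ⊥) : CondIndepFun m' hm' f g μ := by
  subst hbot
  rw [condIndepFun_iff_condExp_inter_preimage_eq_mul hf hg]
  intro s t hs ht
  simp only [condExp_bot]
  refine ae_of_all _ fun ω => ?_
  have key := (indepFun_iff_measure_inter_preimage_eq_mul.1 h) s t hs ht
  have hi : ∀ u : Set Ω, MeasurableSet u → ∫ x, u.indicator (fun _ => (1 : ℝ)) x ∂μ = μ.real u :=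
    fun u hu => by rw [integral_indicator_const _ hu, smul_eq_mul, mul_one]
  change _ = (∫ x, _ ∂μ) * ∫ x, _ ∂μ
  rw [hi _ ((hf hs).inter (hg ht)), hi _ (hf hs), hi _ (hg ht), measureReal_def, measureReal_def,
    measureReal_def, key, ENNReal.toReal_mul]

/-- Under faithfulness, Gaussian variables joined by a path are correlated. -/
lemma covMat_ne_zero_of_reachable {Ω : Type*} [MeasurableSpace Ω] {P : Measure Ω}
    [IsProbabilityMeasure P] {X : Ω → Fin d → ℝ} (hX : Measurable X)
    (hfaith : Faithful G (P.map X)) (hG : HasGaussianLaw X P) {j u : Fin d} (hne : j ≠ u)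
    (hr : G.Reachable j u) : covMat P X j u ≠ 0 := by
  intro h0
  have : IsProbabilityMeasure (P.map X) := Measure.isProbabilityMeasure_map hX.aemeasurable
  have hind : IndepFun (fun ω => X ω j) (fun ω => X ω u) P :=
    (HasGaussianLaw.prodMk (X := fun u ω => X ω u) hG j u).indepFun_of_covariance_eq_zero h0
  have hind' : IndepFun (fun x : Fin d → ℝ => ({j} : Finset (Fin d)).restrict x)
      (fun x : Fin d → ℝ => ({u} : Finset (Fin d)).restrict x) (P.map X) := by
    rw [indepFun_iff_measure_inter_preimage_eq_mul]
    intro s t hs ht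
    have h1 := Finset.measurable_restrict (X := fun _ : Fin d => ℝ) {j} hs
    have h2 := Finset.measurable_restrict (X := fun _ : Fin d => ℝ) {u} ht
    rw [Measure.map_apply hX (h1.inter h2), Measure.map_apply hX h1, Measure.map_apply hX h2]
    have h3 : Measurable fun (a : ℝ) (_ : ({j} : Finset (Fin d))) => a := by fun_prop
    have h4 : Measurable fun (a : ℝ) (_ : ({u} : Finset (Fin d))) => a := by fun_prop
    have h5 := (indepFun_iff_measure_inter_preimage_eq_mul.1 (hind.comp h3 h4)) s t hs ht
    have h6 : ((fun (a : ℝ) (_ : ({j} : Finset (Fin d))) => a) ∘ fun ω => X ω j) =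
        fun ω => ({j} : Finset (Fin d)).restrict (X ω) := by
      ext ω ⟨v, hv⟩
      rw [Finset.mem_singleton] at hv
      subst hv; rfl
    have h7 : ((fun (a : ℝ) (_ : ({u} : Finset (Fin d))) => a) ∘ fun ω => X ω u) =
        fun ω => ({u} : Finset (Fin d)).restrict (X ω) := by
      ext ω ⟨v, hv⟩
      rw [Finset.mem_singleton] at hv
      subst hv; rfl
    rw [h6, h7] at h5
    exact h5
  have hCI : CondIndepOn (P.map X) {j} {u} ∅ := by
    refine condIndepFun_of_eq_bot (Finset.measurable_restrict _) (Finset.measurable_restrict _)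
      hind' _ ?_
    rw [eq_bot_iff]
    rintro _ ⟨s, -, rfl⟩
    rw [MeasurableSpace.measurableSet_bot_iff]
    rcases (Set.subsingleton_of_subsingleton (s := s)).eq_empty_or_singleton with
      rfl | ⟨a, rfl⟩
    · exact Or.inl rfl
    · exact Or.inr (Set.eq_univ_of_forall fun x => Subsingleton.elim _ a)
  have hsep := (hfaith {j} {u} ∅ (by simpa using hne) (by simp) (by simp)).1 hCI
  obtain ⟨w⟩ := hr
  obtain ⟨c, hc, -⟩ := hsep j (by simp) u (by simp) w
  simp at hc

end Faithful

end MMG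

theorem theorem4 {Ω : Type*} [MeasurableSpace Ω] (P : Measure Ω) [IsProbabilityMeasure P]
    {d : ℕ} (G : SimpleGraph (Fin d))
    (X : Ω → Fin d → ℝ) (hX : Measurable X)
    (R : Ω → MMG.Pattern d) (hR : Measurable R)
    (hMCAR : IndepFun X R P)
    (hfaith : MMG.Faithful G (P.map X)) :
    -- recovery of the imputation model
    (∀ r : MMG.Pattern d, P (R ⁻¹' {r}) ≠ 0 →
      (∀ s ∈ MMG.missComps G r, P (MMG.obsEvent R (MMG.closedNbhd G s)) ≠ 0) →
      ∀ᵐ ω ∂P,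
        MMG.npMMG P X R G r (X ω) = MMG.extrapolation P X R r (X ω) ∧
        MMG.npMMG P X R G r (X ω) = MMG.trueConditional P X r (X ω)) ∧
    -- efficiency in the Gaussian case
    (HasGaussianLaw X P →
      (Matrix.of fun u v => cov[fun ω => X ω u, fun ω => X ω v; P]).PosDef →
      P {ω | ∀ v, R ω v = true} ≠ 0 →
      ∀ j : Fin d, ∃ VG VC : NNReal,
        VG ≤ VC ∧
        ((∃ r : MMG.Pattern d, P (R ⁻¹' {r}) ≠ 0 ∧ (∃ u, r u = false) ∧
            ∃ v, r v = true ∧ G.Reachable j v) → VG < VC) ∧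
        ∀ {Ω' : Type*} [MeasurableSpace Ω'] (P' : Measure Ω') [IsProbabilityMeasure P']
          (X' : ℕ → Ω' → Fin d → ℝ) (R' : ℕ → Ω' → MMG.Pattern d),
          iIndepFun (fun i ω => (X' i ω, R' i ω)) P' →
          (∀ i, Measurable (X' i)) → (∀ i, Measurable (R' i)) →
          (∀ i, IdentDistrib (fun ω => (X' i ω, R' i ω)) (fun ω => (X ω, R ω)) P' P) →
          MMG.HasAsympVar P' (fun n ω => MMG.ccEstimator j n (fun i => X' i ω) fun i => R' i ω)
            (∫ ω, X ω j ∂P) VC ∧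
          ∀ θ : ℕ → (s : Finset (Fin d)) → Ω' → MMG.GaussParam (MMG.closedNbhd G s),
            MMG.IsGaussianFit G X' R' θ →
            MMG.HasAsympVar P'
              (fun n ω => MMG.gmmgEstimator G (fun s => θ n s ω) j n
                (fun i => X' i ω) fun i => R' i ω)
              (∫ ω, X ω j ∂P) VG) := by
  refine ⟨fun r hr hs => MMG.npMMG_ae_eq hX hR hMCAR hfaith hr hs, fun hG hpd hc j => ?_⟩
  have h : MMG.RegularMCAR P X R :=
    ⟨hX, hR, hMCAR, fun u => (HasGaussianLaw.eval (X := fun u ω => X ω u) hG u).memLp_two, hpd, hc⟩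
  refine ⟨(Var[MMG.gmmgInfluence P X R G j; P]).toNNReal,
    (Var[MMG.ccInfluence P X R j; P]).toNNReal,
    Real.toNNReal_le_toNNReal h.variance_gmmgInfluence_le_cc, ?_, ?_⟩
  · rintro ⟨r, hP, hinc, v, hv, hreach⟩
    have hlt : Var[MMG.gmmgInfluence P X R G j; P] < Var[MMG.ccInfluence P X R j; P] := by
      refine h.variance_gmmgInfluence_lt_cc hP hinc fun hj => ?_
      obtain ⟨u, hu, hju⟩ := MMG.exists_mem_nbhd_of_reachable hj hv hreach
      refine ⟨u, hu, MMG.covMat_ne_zero_of_reachable hX hfaith hG ?_ hju⟩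
      rintro rfl
      exact (MMG.mem_nbhd.1 hu).1 (MMG.mem_missComp_self G hj)
    exact (Real.toNNReal_lt_toNNReal_iff ((variance_nonneg _ _).trans_lt hlt)).2 hlt
  · intro Ω' _ P' _ X' R' hindep hX' hR' hid
    exact ⟨h.hasAsympVar_ccEstimator hindep hX' hR' hid j,
      fun θ hθ => h.hasAsympVar_gmmgEstimator hindep hX' hR' hid hθ j⟩
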